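/- Let $\mathcal C$ be a small category, identified with its set of morphisms; vertices are identified with identity morphisms, $s(\alpha)$ and $r(\alpha)$ denote source and range, $\alpha\beta$ is defined iff $s(\alpha)=r(\beta)$, $\alpha\mathcal C=\{\alpha\beta : r(\beta)=s(\alpha)\}$, and $v\mathcal C=\{\alpha : r(\alpha)=v\}$ for a vertex $v$. Assume that $\mathcal C$ is left cancellative ($\alpha\beta=\alpha\gamma$ implies $\beta=\gamma$) and finitely aligned (each $\alpha\mathcal C\cap\beta\mathcal C$ equals $\bigcup_{\gamma\in F}\gamma\mathcal C$ for some finite, possibly empty, set $F$). Write $\alpha\vee\beta$ for any such $F$ that is independent, i.e. $\gamma\notin\gamma'\mathcal C$ for distinct $\gamma,\gamma'\in F$. A representation of $\mathcal C$ in a $C^*$-algebra $B$ (not necessarily unital) is a map $T:\mathcal C\to B$ such that (1) $T_\alpha^*T_\alpha=T_{s(\alpha)}$; (2) $T_\alpha T_\beta=T_{\alpha\beta}$ if $s(\alpha)=r(\beta)$; (3) $T_\alpha T_\alpha^*T_\beta T_\beta^*=\bigvee_{\gamma\in\alpha\vee\beta}T_\gamma T_\gamma^*$. It is covariant if moreover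 (4) $T_v=\bigvee_{\alpha\in F}T_\alpha T_\alpha^*$ for every vertex $v$ and every finite $F\subseteq v\mathcal C$ that is exhaustive at $v$, i.e. for each $\alpha\in v\mathcal C$ there is $\beta\in F$ with $\alpha\mathcal C\cap\beta\mathcal C\neq\varnothing$. (Joins of projections; the empty join is $0$.) A Cuntz–Krieger algebra $(\mathcal O(\mathcal C),\tilde t)$ is a $C^*$-algebra with a covariant representation $\tilde t$ such that every covariant representation $T$ of $\mathcal C$ in a $C^*$-algebra $B$ is $\psi\circ\tilde t$ for a unique $*$-homomorphism $\psi:\mathcal O(\mathcal C)\to B$. Let $\mathrm{ZM}(\mathcal C)$ be the inverse semigroup of partial bijections of $\mathcal C$ generated by the shifts $\tau_\alpha:s(\alpha)\mathcal C\to\alpha\mathcal C$, $\beta\mapsto\alpha\beta$ $(\alpha\in\mathcal C)$, and the empty map $0$. For an inverse semigroup $S$ with zero, ordered by $s\le t\iff s=ss^*t$, a representation of $S$ in $B$ is a map $\pi:S\to B$ with $\pi(st)=\pi(s)\pi(t)$, $\pi(s^*)=\pi(s)^*$, $\pi(0)=0$. A finite set $C\subseteq S$ is a cover of $a\in S$ if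 $c\le a$ for all $c\in C$, and for every nonzero $s\le a$ there are $c\in C$ and a nonzero $b\in S$ with $b\le s$ and $b\le c$. A representation $\pi$ of $S$ in $B$ is cover-to-join if, whenever $C$ is a cover of $a$, $\pi(a)$ is the join (least upper bound) of $\pi(C)$ among the partial isometries of $B$, ordered by $x\le y\iff x=xx^*y$. It is tight (in Exel's sense) if for all finite sets $X,Y$ of idempotents of $S$ and every finite subset $Z$ of $E^{X,Y}=\{e=e^2\in S : ex=e\ \forall x\in X,\ ey=0\ \forall y\in Y\}$ such that each nonzero $e\in E^{X,Y}$ satisfies $ez\ne0$ for some $z\in Z$, one has $$\bigvee_{z\in Z}\pi(z)=\prod_{x\in X}\pi(x)\prod_{y\in Y}(1-\pi(y)),$$ where $1$ is the unit of the multiplier algebra of the $C^*$-subalgebra of $B$ generated by $\pi(S)$. The tight $C^*$-algebra of $S$ is the $C^*$-algebra with a tight representation of $S$ that is universal for tight representations of $S$ in $C^*$-algebras. **Theorem.** (a) For every representation $T$ of $\mathcal C$ in a $C^*$-algebra $B$ there is a unique representation $\pi_T$ of $\mathrm{ZM}(\mathcal C)$ in $B$ with $\pi_T(\tau_\alpha)=T_\alpha$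 for all $\alpha$; and $T$ is covariant if and only if $\pi_T$ is cover-to-join, if and only if $\pi_T$ is tight. (b) $\mathcal O(\mathcal C)$ is the tight $C^*$-algebra of $\mathrm{ZM}(\mathcal C)$: there is a Cuntz–Krieger algebra $(\mathcal O(\mathcal C),\tilde t)$ of $\mathcal C$ such that $(\mathcal O(\mathcal C),\pi_{\tilde t})$ is the tight $C^*$-algebra of $\mathrm{ZM}(\mathcal C)$; and for every representation $\pi$ of $\mathrm{ZM}(\mathcal C)$ in a $C^*$-algebra $A$, the pair $(A,\pi\circ\tau)$ is a Cuntz–Krieger algebra of $\mathcal C$ if and only if $(A,\pi)$ is the tight $C^*$-algebra of $\mathrm{ZM}(\mathcal C)$. -/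

import Mathlib

open CategoryTheory

universe u v w x

namespace LCSC

/-! ## Small categories, viewed through their set of morphisms

For a category `V` we write `Arrow V` for the set `𝒞` of all morphisms. The source of `α : Arrow V`
is `α.left` and its range is `α.right`. A vertex `v` is identified with the identity morphism
`Arrow.mk (𝟙 v)`. The product `αβ` is defined when `s(α) = r(β)`, and means "first `β`, then `α`". -/

section Categories

variable {V : Type u} [Category.{v} V]

/-- The product `αβ` of two morphisms with `s(α) = r(β)`. -/
def comp (α β : Arrow V) (h : α.left = β.right) : Arrow V :=
  Arrow.mk (β.hom ≫ eqToHom h.symm ≫ α.hom)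

/-- `𝒞` is left cancellative: `αβ = αγ` implies `β = γ`. -/
class LeftCancellative (V : Type u) [Category.{v} V] : Prop where
  cancel : ∀ (α β γ : Arrow V) (hβ : α.left = β.right) (hγ : α.left = γ.right),
    comp α β hβ = comp α γ hγ → β = γ

/-- The right ideal `α𝒞 = {αβ : s(α) = r(β)}`. -/
def ideal (α : Arrow V) : Set (Arrow V) :=
  {γ | ∃ (β : Arrow V) (h : α.left = β.right), comp α β h = γ}

/-- `𝒞` is finitely aligned: every `α𝒞 ∩ β𝒞` is `F𝒞` for some finite (possibly empty) `F`. -/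
def FinitelyAligned (V : Type u) [Category.{v} V] : Prop :=
  ∀ α β : Arrow V, ∃ F : Finset (Arrow V), ideal α ∩ ideal β = ⋃ γ ∈ F, ideal γ

/-- `F` is independent: `γ ∉ γ'𝒞` for distinct `γ, γ' ∈ F`. -/
def Independent (F : Finset (Arrow V)) : Prop :=
  ∀ γ ∈ F, ∀ γ' ∈ F, γ ≠ γ' → γ ∉ ideal γ'

/-- `L` is a choice of `α ∨ β`: a finite independent set with `α𝒞 ∩ β𝒞 = L𝒞`. -/
def IsVee (α β : Arrow V) (L : Finset (Arrow V)) : Prop :=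
  Independent L ∧ ideal α ∩ ideal β = ⋃ γ ∈ L, ideal γ

/-- `F ⊆ v𝒞` is exhaustive at the vertex `v`. -/
def Exhaustive (v : V) (F : Finset (Arrow V)) : Prop :=
  (∀ β ∈ F, β.right = v) ∧
    ∀ α : Arrow V, α.right = v → ∃ β ∈ F, (ideal α ∩ ideal β).Nonempty

end Categories

/-! ## Joins in a C*-algebra -/

section Joins

variable {B : Type*} [NonUnitalCStarAlgebra B]

/-- `q` is the join of the set `P` of projections of `B`: the least upper bound of `P` among the
projections of `B`, where `p ≤ q` means `p = p * q`. The join of the empty set is `0`. -/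
def IsProjJoin (P : Set B) (q : B) : Prop :=
  IsStarProjection q ∧ (∀ p ∈ P, p = p * q) ∧
    ∀ r : B, IsStarProjection r → (∀ p ∈ P, p = p * r) → q = q * r

/-- `a` is a partial isometry. -/
def IsPartialIsometry (a : B) : Prop := a * star a * a = a

/-- The natural partial order `a ≤ b` of partial isometries: `a = a a* b`. -/
def PartialIsometryLE (a b : B) : Prop := a = a * star a * b

/-- `q` is the join of the set `P` of partial isometries of `B`: the least upper bound of `P` among
the partial isometries of `B`, in their natural partial order. -/
def IsPartialIsometryJoin (P : Set B) (q : B) : Prop :=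
  IsPartialIsometry q ∧ (∀ a ∈ P, PartialIsometryLE a q) ∧
    ∀ r : B, IsPartialIsometry r → (∀ a ∈ P, PartialIsometryLE a r) → PartialIsometryLE q r

end Joins

/-! ## Representations of `𝒞` and the Cuntz-Krieger algebra -/

section Representations

variable {V : Type u} [Category.{v} V]

/-- A representation of `𝒞` in a C*-algebra `B`. -/
structure IsRepresentation {B : Type w} [NonUnitalCStarAlgebra B] (T : Arrow V → B) : Prop where
  star_mul_self : ∀ α : Arrow V, star (T α) * T α = T (Arrow.mk (𝟙 α.left))
  mul : ∀ (α β : Arrow V) (h : α.left = β.right), T α * T β = T (comp α β h)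
  range_mul_range : ∀ (α β : Arrow V) (L : Finset (Arrow V)), IsVee α β L →
    IsProjJoin ((fun γ => T γ * star (T γ)) '' (L : Set (Arrow V)))
      (T α * star (T α) * (T β * star (T β)))

/-- A covariant representation of `𝒞` in a C*-algebra `B`. -/
structure IsCovariant {B : Type w} [NonUnitalCStarAlgebra B] (T : Arrow V → B) : Prop
    extends IsRepresentation T where
  exhaustive : ∀ (v : V) (F : Finset (Arrow V)), Exhaustive v F →
    IsProjJoin ((fun α => T α * star (T α)) '' (F : Set (Arrow V))) (T (Arrow.mk (𝟙 v)))

/-- `(A, t)` is a Cuntz-Krieger algebra of `𝒞`: `t` is a covariant representation of `𝒞` in `A`,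
and every covariant representation `T` of `𝒞` in a C*-algebra `B` is `ψ ∘ t` for a unique
*-homomorphism `ψ : A → B`. -/
def IsCuntzKriegerAlgebra.{w', x', u', v'} {V : Type u'} [Category.{v'} V]
    {A : Type x'} [NonUnitalCStarAlgebra A] (t : Arrow V → A) : Prop :=
  IsCovariant t ∧
    ∀ (B : Type w') [NonUnitalCStarAlgebra B] (T : Arrow V → B), IsCovariant T →
      ∃! ψ : A →⋆ₙₐ[ℂ] B, ∀ α, ψ (t α) = T α

end Representations

/-! ## Inverse semigroups with zero, covers and tightness -/

/-- Inverse semigroups with zero; `star s` is the inverse `s*` of `s`. -/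
class InverseSemigroupWithZero (S : Type*) extends SemigroupWithZero S, StarMul S where
  mul_star_mul : ∀ s : S, s * star s * s = s
  idem_comm : ∀ e f : S, e * e = e → f * f = f → e * f = f * e

section InverseSemigroups

variable {S : Type*} [InverseSemigroupWithZero S]

/-- The natural partial order of an inverse semigroup: `s ≤ t` iff `s = s s* t`. -/
def NaturalLE (s t : S) : Prop := s = s * star s * t

/-- The finite set `C` is a cover of `a`. -/
def IsCover (C : Finset S) (a : S) : Prop :=
  (∀ c ∈ C, NaturalLE c a) ∧
    ∀ s : S, s ≠ 0 → NaturalLE s a → ∃ c ∈ C, ∃ b : S, b ≠ 0 ∧ NaturalLE b s ∧ NaturalLE b c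

/-- A (zero-preserving) representation of an inverse semigroup in a C*-algebra. -/
structure IsSemigroupRep {B : Type w} [NonUnitalCStarAlgebra B] (π : S → B) : Prop where
  map_mul : ∀ s t, π (s * t) = π s * π t
  map_star : ∀ s, π (star s) = star (π s)
  map_zero : π 0 = 0

/-- `π` is cover-to-join: `π(a)` is the join of `π(C)` whenever `C` is a cover of `a`. -/
def IsCoverToJoin {B : Type w} [NonUnitalCStarAlgebra B] (π : S → B) : Prop :=
  ∀ (a : S) (C : Finset S), IsCover C a → IsPartialIsometryJoin (π '' (C : Set S)) (π a)

/-- The set `E^{X,Y}` of the idempotents that lie below every element of `X` and are orthogonal to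
every element of `Y`. -/
def idemBetween (X Y : List S) : Set S :=
  {z | z * z = z ∧ (∀ x ∈ X, z * x = z) ∧ ∀ y ∈ Y, z * y = 0}

/-- `Z` is a cover, within the semilattice of idempotents, of the set `F` of idempotents: it is a
finite subset of `F`, and every nonzero element of `F` meets an element of `Z`. -/
def IsIdemCover (Z : Finset S) (F : Set S) : Prop :=
  (Z : Set S) ⊆ F ∧ ∀ f ∈ F, f ≠ 0 → ∃ z ∈ Z, z * f ≠ 0

/-- `π` is tight in the sense of Exel: for all finite families `X`, `Y` of idempotents (possibly
empty) and every finite cover `Z` of `E^{X,Y}`,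
`⋁_{z ∈ Z} π(z) = ∏_{x ∈ X} π(x) * ∏_{y ∈ Y} (1 - π(y))`.
Here `1` is the unit of the multiplier algebra of the C*-algebra generated by `π(S)`. That
C*-algebra is the closed linear span of `π(S)`, so two multipliers agree iff they agree after
multiplication with every `π(s)`; the products are computed in the unitization of `B`. -/
def IsTight {B : Type w} [NonUnitalCStarAlgebra B] (π : S → B) : Prop :=
  ∀ (X Y : List S) (Z : Finset S), (∀ x ∈ X, x * x = x) → (∀ y ∈ Y, y * y = y) →
    IsIdemCover Z (idemBetween X Y) →
    ∃ q : B, IsProjJoin (π '' (Z : Set S)) q ∧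
      ∀ s : S, (q : Unitization ℂ B) * (π s : Unitization ℂ B) =
        (X.map fun x => (π x : Unitization ℂ B)).prod *
          (Y.map fun y => 1 - (π y : Unitization ℂ B)).prod * (π s : Unitization ℂ B)

/-- `(A, π)` is the tight C*-algebra of `S`: it is universal for tight representations of `S`. -/
def IsTightCStarAlgebra.{w', x', s'} {S : Type s'} [InverseSemigroupWithZero S]
    {A : Type x'} [NonUnitalCStarAlgebra A] (π : S → A) : Prop :=
  IsSemigroupRep π ∧ IsTight π ∧
    ∀ (B : Type w') [NonUnitalCStarAlgebra B] (ρ : S → B), IsSemigroupRep ρ → IsTight ρ →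
      ∃! φ : A →⋆ₙₐ[ℂ] B, ∀ s, φ (π s) = ρ s

end InverseSemigroups

/-! ## The inverse semigroup `ZM(𝒞)` -/

section ZigzagMaps

variable {V : Type u} [Category.{v} V]

open Classical in
/-- The shift `τ_α : s(α)𝒞 → α𝒞`, `β ↦ αβ`, as a partial bijection of `𝒞`. -/
noncomputable def shift [LeftCancellative V] (α : Arrow V) : Arrow V ≃. Arrow V where
  toFun β := if h : α.left = β.right then some (comp α β h) else none
  invFun γ := if h : ∃ (β : Arrow V) (h : α.left = β.right), comp α β h = γ
    then some h.choose else none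
  inv β γ := by
    constructor
    · intro hb
      by_cases h : ∃ (β : Arrow V) (h : α.left = β.right), comp α β h = γ
      · simp only [h, dite_true, Option.some.injEq] at hb
        obtain ⟨h1, h2⟩ := h.choose_spec
        subst hb
        rw [dif_pos h1]
        exact congrArg some h2
      · simp [h] at hb
    · intro hg
      by_cases h1 : α.left = β.right
      · simp only [h1, dite_true, Option.some.injEq] at hg
        have h : ∃ (β : Arrow V) (h : α.left = β.right), comp α β h = γ := ⟨β, h1, hg⟩
        obtain ⟨h2, h3⟩ := h.choose_spec
        have h4 := LeftCancellative.cancel α _ β h2 h1 (h3.trans hg.symm)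
        simp only [h, dite_true, Option.some.injEq]
        exact h4
      · simp [h1] at hg

/-- Membership in the inverse semigroup of partial bijections of `𝒞` generated by the shifts
`τ_α` and the empty map. -/
inductive ZMMem [LeftCancellative V] : (Arrow V ≃. Arrow V) → Prop
  | empty : ZMMem ⊥
  | shift (α : Arrow V) : ZMMem (shift α)
  | symm (f : Arrow V ≃. Arrow V) : ZMMem f → ZMMem f.symm
  | mul (f g : Arrow V ≃. Arrow V) : ZMMem f → ZMMem g → ZMMem (g.trans f)

/-- The inverse semigroup `ZM(𝒞)`. -/
def ZM (V : Type u) [Category.{v} V] [LeftCancellative V] : Type (max u v) :=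
  {f : Arrow V ≃. Arrow V // ZMMem f}

theorem eq_of_idem {X : Type*} (e : X ≃. X) (he : e.trans e = e) {a b : X}
    (h : e a = some b) : a = b := by
  have h1 : (e.trans e) a = some b := by rw [he]; exact h
  rw [PEquiv.trans_eq_some] at h1
  obtain ⟨c, hc, hcb⟩ := h1
  have hbc : c = b := by rw [h] at hc; exact (Option.some.inj hc).symm
  subst hbc
  exact e.inj h hcb

theorem idem_trans_comm {X : Type*} (e f : X ≃. X) (he : e.trans e = e) (hf : f.trans f = f) :
    e.trans f = f.trans e := by
  have key : ∀ (e f : X ≃. X), e.trans e = e → f.trans f = f → ∀ a b : X,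
      (e.trans f) a = some b → (f.trans e) a = some b := by
    intro e f he hf a b h
    rw [PEquiv.trans_eq_some] at h ⊢
    obtain ⟨c, h1, h2⟩ := h
    have h3 := eq_of_idem e he h1
    have h4 := eq_of_idem f hf h2
    subst h3; subst h4
    exact ⟨_, h2, h1⟩
  ext a b
  exact ⟨key e f he hf a b, key f e hf he a b⟩

theorem trans_symm_trans {X : Type*} (f : X ≃. X) : (f.trans f.symm).trans f = f := by
  ext a b
  change b ∈ (f.trans f.symm).trans f a ↔ b ∈ f a
  simp only [PEquiv.mem_trans]
  constructor
  · rintro ⟨c, ⟨d, h1, h2⟩, h3⟩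
    rw [PEquiv.mem_iff_mem] at h2
    have := f.inj h1 h2
    subst this
    exact h3
  · intro h
    exact ⟨a, ⟨b, h, (PEquiv.mem_iff_mem f).2 h⟩, h⟩

/-- In `ZM(𝒞)` the product `φψ` is composition (first `ψ`, then `φ`) on the largest possible
domain, `star φ` is the inverse map, and `0` is the empty map. -/
noncomputable instance [LeftCancellative V] : InverseSemigroupWithZero (ZM V) where
  mul f g := ⟨g.1.trans f.1, ZMMem.mul _ _ f.2 g.2⟩
  zero := ⟨⊥, ZMMem.empty⟩
  star f := ⟨f.1.symm, ZMMem.symm _ f.2⟩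
  mul_assoc f g h := Subtype.ext (PEquiv.trans_assoc h.1 g.1 f.1).symm
  zero_mul f := Subtype.ext (PEquiv.trans_bot f.1)
  mul_zero f := Subtype.ext (PEquiv.bot_trans f.1)
  star_involutive f := Subtype.ext (PEquiv.symm_symm f.1)
  star_mul f g := Subtype.ext (PEquiv.symm_trans_rev g.1 f.1)
  mul_star_mul f := Subtype.ext
    ((PEquiv.trans_assoc f.1 f.1.symm f.1).symm.trans (trans_symm_trans f.1))
  idem_comm e f he hf := Subtype.ext
    (idem_trans_comm f.1 e.1 (congrArg Subtype.val hf) (congrArg Subtype.val he))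

/-- The shift `τ_α` as an element of `ZM(𝒞)`. -/
noncomputable def tau [LeftCancellative V] (α : Arrow V) : ZM V := ⟨shift α, ZMMem.shift α⟩

/-- `π` is a representation of `ZM(𝒞)` associated with the map `T : 𝒞 → B`, that is,
`π ∘ τ = T`. Such a `π` is determined by `T` since `ZM(𝒞)` is generated by the `τ_α`. -/
def IsAssociated [LeftCancellative V] {B : Type w} [NonUnitalCStarAlgebra B]
    (T : Arrow V → B) (π : ZM V → B) : Prop :=
  IsSemigroupRep π ∧ ∀ α, π (tau α) = T α

end ZigzagMaps

end LCSC

/-! In a representation `T`, an element of `B` can be recognised by its action on the elements `T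
β`. An element `x` implements a zigzag map `f` if `x * T β = T γ` whenever `f` sends `β` to `γ`, if
`x` kills everything orthogonal to the ranges of the `T β` with `β` in the domain, and if `star x`
does the same for the inverse map. By the C*-identity at most one `x` implements `f`
(`Implements.unique`). Implementing elements are closed under adjoints and, by finite alignment,
under products (`Implements.actsAs_mul`). Induction on words in the generators therefore gives
existence, and uniqueness makes the assignment a representation of `ZM V`.

Domains of zigzag maps are finitely generated right ideals (`ZM.finGen_dom`). If finitely many
domains jointly meet every principal right ideal inside `β𝒞`, their generators, pulled back along
`τ_β`, form a finite exhaustive set at `s(β)`. Hence, for covariant `T`, an element killed by `star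
(T ε)` for all `ε ∈ β𝒞` in these domains is killed by `star (T β)` (`IsCovariant.star_mul_eq_zero`).
Tightness and the cover-to-join property both reduce to vanishing statements of this kind.
Conversely, the joins in (3) and (4) come from covers by idempotents `τ_γ τ_γ*`.

For (b), the correspondence between `T` and its extension is compatible with *-homomorphisms, so the
two universal properties coincide. A universal object is the completion of `MonoidAlgebra ℂ (ZM V)`
in the supremum of the C*-seminorms of covariant representations. Joins of commuting projections are
polynomials in them, so covariance is inherited by the completion. -/

namespace LCSC

/-! ### Right ideals and finite generation -/

section Products

variable {V : Type u} [Category.{v} V]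

theorem comp_id (α : Arrow V) : comp α (Arrow.mk (𝟙 α.left)) rfl = α := by
  simp [comp]

theorem id_comp (α : Arrow V) : comp (Arrow.mk (𝟙 α.right)) α rfl = α := by
  simp [comp]

theorem comp_assoc (α β γ : Arrow V) (h : α.left = β.right) (h' : β.left = γ.right) :
    comp (comp α β h) γ h' = comp α (comp β γ h') h := by
  simp [comp]

theorem self_mem_ideal (α : Arrow V) : α ∈ ideal α := ⟨_, rfl, comp_id α⟩

theorem comp_mem_ideal (α β : Arrow V) (h : α.left = β.right) : comp α β h ∈ ideal α :=
  ⟨β, h, rfl⟩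

theorem ideal_subset_ideal {α β : Arrow V} (h : β ∈ ideal α) : ideal β ⊆ ideal α := by
  obtain ⟨δ, hδ, rfl⟩ := h
  rintro _ ⟨ε, hε, rfl⟩
  exact ⟨comp δ ε hε, hδ, (comp_assoc _ _ _ _ _).symm⟩

theorem right_eq_of_mem_ideal {α β : Arrow V} (h : β ∈ ideal α) : β.right = α.right := by
  obtain ⟨δ, hδ, rfl⟩ := h
  rfl

theorem mem_ideal_id {α : Arrow V} {v : V} (h : α.right = v) : α ∈ ideal (Arrow.mk (𝟙 v)) := by
  subst h
  exact ⟨α, rfl, id_comp α⟩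

/-- A right ideal is finitely generated if it is a finite union of principal right ideals. -/
def FinGen (I : Set (Arrow V)) : Prop :=
  ∃ F : Finset (Arrow V), I = ⋃ γ ∈ F, ideal γ

theorem finGen_ideal (α : Arrow V) : FinGen (ideal α) := ⟨{α}, by simp⟩

open Classical in
theorem finGen_biUnion {ι : Type*} (s : Finset ι) (I : ι → Set (Arrow V))
    (h : ∀ i ∈ s, FinGen (I i)) : FinGen (⋃ i ∈ s, I i) := by
  choose! F hF using h
  refine ⟨s.biUnion F, ?_⟩
  ext α
  simp only [Set.mem_iUnion, Finset.mem_biUnion, exists_prop]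
  constructor
  · rintro ⟨i, hi, hα⟩
    rw [hF i hi] at hα
    simp only [Set.mem_iUnion, exists_prop] at hα
    obtain ⟨γ, hγ, h⟩ := hα
    exact ⟨γ, ⟨i, hi, hγ⟩, h⟩
  · rintro ⟨γ, ⟨i, hi, hγ⟩, h⟩
    refine ⟨i, hi, ?_⟩
    rw [hF i hi]
    simp only [Set.mem_iUnion, exists_prop]
    exact ⟨γ, hγ, h⟩

theorem FinGen.inter (hV : FinitelyAligned V) {I J : Set (Arrow V)} (hI : FinGen I)
    (hJ : FinGen J) : FinGen (I ∩ J) := by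
  obtain ⟨F, rfl⟩ := hI
  obtain ⟨G, rfl⟩ := hJ
  have h : (⋃ γ ∈ F, ideal γ) ∩ (⋃ γ ∈ G, ideal γ) =
      ⋃ p ∈ F ×ˢ G, ideal p.1 ∩ ideal p.2 := by
    ext α
    simp only [Set.mem_inter_iff, Set.mem_iUnion, exists_prop, Finset.mem_product, Prod.exists]
    constructor
    · rintro ⟨⟨γ, hγ, h⟩, δ, hδ, h'⟩
      exact ⟨γ, δ, ⟨hγ, hδ⟩, h, h'⟩
    · rintro ⟨γ, δ, ⟨hγ, hδ⟩, h, h'⟩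
      exact ⟨⟨γ, hγ, h⟩, δ, hδ, h'⟩
  rw [h]
  exact finGen_biUnion _ _ fun p _ => hV p.1 p.2

/-- In a finitely aligned category `α ∨ β` exists. -/
theorem FinitelyAligned.exists_isVee (hV : FinitelyAligned V) (α β : Arrow V) :
    ∃ L, IsVee α β L := by
  classical
  -- A generating set of least cardinality is independent, since a generator lying in the ideal of
  -- another could be erased.
  have hex : ∃ n, ∃ F : Finset (Arrow V), F.card = n ∧ ideal α ∩ ideal β = ⋃ γ ∈ F, ideal γ := by
    obtain ⟨F, hF⟩ := hV α β
    exact ⟨_, F, rfl, hF⟩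
  obtain ⟨F, hcard, hF⟩ := Nat.find_spec hex
  refine ⟨F, ?_, hF⟩
  intro γ hγ γ' hγ' hne hmem
  refine Nat.find_min hex (m := (F.erase γ).card) ?_ ⟨F.erase γ, rfl, ?_⟩
  · rw [← hcard]
    exact Finset.card_erase_lt_of_mem hγ
  · rw [hF]
    ext δ
    simp only [Set.mem_iUnion, exists_prop, Finset.mem_erase]
    constructor
    · rintro ⟨ε, hε, h⟩
      by_cases hεγ : ε = γ
      · subst hεγ
        exact ⟨γ', ⟨hne.symm, hγ'⟩, ideal_subset_ideal hmem h⟩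
      · exact ⟨ε, ⟨hεγ, hε⟩, h⟩
    · rintro ⟨ε, ⟨_, hε⟩, h⟩
      exact ⟨ε, hε, h⟩

end Products

/-! ### Zigzag maps and their domains -/

section ZigzagElements

variable {V : Type u} [Category.{v} V] [LeftCancellative V]

/-- The graph of an element of `ZM(𝒞)`. -/
def ZM.Maps (f : ZM V) (β γ : Arrow V) : Prop := f.1 β = some γ

theorem ZM.ext_maps {f g : ZM V} (h : ∀ β γ, f.Maps β γ ↔ g.Maps β γ) : f = g :=
  Subtype.ext (PEquiv.ext fun β => Option.ext (h β))

theorem ZM.maps_mul {f g : ZM V} {α γ : Arrow V} :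
    (f * g).Maps α γ ↔ ∃ β, g.Maps α β ∧ f.Maps β γ :=
  PEquiv.trans_eq_some g.1 f.1 α γ

theorem ZM.maps_star {f : ZM V} {β γ : Arrow V} : (star f).Maps γ β ↔ f.Maps β γ :=
  PEquiv.eq_some_iff f.1

theorem ZM.not_maps_zero {β γ : Arrow V} : ¬ (0 : ZM V).Maps β γ := by
  intro h
  exact Option.some_ne_none γ h.symm

theorem ZM.maps_tau {α β γ : Arrow V} :
    (tau α).Maps β γ ↔ ∃ h : α.left = β.right, comp α β h = γ := by
  change shift α β = some γ ↔ _
  by_cases h : α.left = β.right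
  · simp [shift, h]
  · simp [shift, h]

theorem ZM.Maps.functional {f : ZM V} {β γ γ' : Arrow V} (h : f.Maps β γ) (h' : f.Maps β γ') :
    γ = γ' :=
  Option.some.inj (h.symm.trans h')

theorem ZM.Maps.injective {f : ZM V} {β β' γ : Arrow V} (h : f.Maps β γ) (h' : f.Maps β' γ) :
    β = β' :=
  (maps_star.2 h).functional (maps_star.2 h')

theorem ZM.ne_zero_iff {f : ZM V} : f ≠ 0 ↔ ∃ β γ, f.Maps β γ := by
  constructor
  · intro h
    by_contra! h'
    exact h (ZM.ext_maps fun β γ => ⟨fun h => (h' β γ h).elim, fun h => (not_maps_zero h).elim⟩)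
  · rintro ⟨β, γ, h⟩ rfl
    exact not_maps_zero h

theorem ZM.induction_maps {p : ZM V → Prop} (zero : p 0) (tau : ∀ α, p (tau α))
    (star : ∀ f, p f → p (star f)) (mul : ∀ f g, p f → p g → p (f * g)) (f : ZM V) : p f := by
  obtain ⟨f, hf⟩ := f
  induction hf with
  | empty => exact zero
  | shift α => exact tau α
  | symm f hf ih => exact star ⟨f, hf⟩ ih
  | mul f g hf hg ihf ihg => exact mul ⟨f, hf⟩ ⟨g, hg⟩ ihf ihg

/-- Zigzag maps commute with right multiplication. -/
theorem ZM.maps_comp (f : ZM V) : ∀ {β γ : Arrow V}, f.Maps β γ →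
    β.left = γ.left ∧ ∀ (δ : Arrow V) (h : β.left = δ.right) (h' : γ.left = δ.right),
      f.Maps (comp β δ h) (comp γ δ h') := by
  induction f using ZM.induction_maps with
  | zero => exact fun h => (not_maps_zero h).elim
  | tau α =>
    intro β γ h
    obtain ⟨h0, rfl⟩ := maps_tau.1 h
    exact ⟨rfl, fun δ h1 h2 => maps_tau.2 ⟨h0, (comp_assoc _ _ _ _ _).symm⟩⟩
  | star f ih =>
    intro β γ h
    obtain ⟨h1, h2⟩ := ih (maps_star.1 h)
    exact ⟨h1.symm, fun δ h h' => maps_star.2 (h2 δ h' h)⟩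
  | mul f g ihf ihg =>
    intro α γ h
    obtain ⟨β, h1, h2⟩ := maps_mul.1 h
    obtain ⟨h3, h4⟩ := ihg h1
    obtain ⟨h5, h6⟩ := ihf h2
    exact ⟨h3.trans h5, fun δ h h' =>
      maps_mul.2 ⟨comp β δ (h3.symm.trans h), h4 _ _ _, h6 _ _ _⟩⟩

/-- The domain of an element of `ZM(𝒞)`. -/
def ZM.dom (f : ZM V) : Set (Arrow V) := {β | ∃ γ, f.Maps β γ}

theorem ZM.mem_dom_of_mem_ideal {f : ZM V} {α β : Arrow V} (h : α ∈ f.dom) (hβ : β ∈ ideal α) :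
    β ∈ f.dom := by
  obtain ⟨γ, h⟩ := h
  obtain ⟨δ, hδ, rfl⟩ := hβ
  obtain ⟨h1, h2⟩ := f.maps_comp h
  exact ⟨_, h2 δ hδ (h1.symm.trans hδ)⟩

/-- The domain of `f * g` is the preimage under `g` of the range of `g` intersected with the domain
of `f`. That intersection is finitely generated, and since `g` commutes with right multiplication,
preimages of its generators generate the preimage. -/
theorem ZM.finGen_dom_mul (hV : FinitelyAligned V) {f g : ZM V} (hf : FinGen f.dom)
    (hg : FinGen (star g).dom) : FinGen (f * g).dom := by
  classical
  rcases isEmpty_or_nonempty (Arrow V) with hemp | hne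
  · exact ⟨∅, Set.ext fun α => hemp.elim α⟩
  obtain ⟨F, hF⟩ := hg.inter hV hf
  have hex : ∀ ε ∈ F, ∃ δ, g.Maps δ ε := by
    intro ε hε
    have : ε ∈ (star g).dom ∩ f.dom := by
      rw [hF]
      exact Set.mem_biUnion hε (self_mem_ideal ε)
    obtain ⟨δ, hδ⟩ := this.1
    exact ⟨δ, maps_star.1 hδ⟩
  choose! pre hpre using hex
  refine ⟨F.image pre, ?_⟩
  ext α
  simp only [Set.mem_iUnion, exists_prop, Finset.mem_image, exists_exists_and_eq_and]
  constructor
  · rintro ⟨γ, h⟩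
    obtain ⟨β, h1, h2⟩ := maps_mul.1 h
    have hβ : β ∈ (star g).dom ∩ f.dom := ⟨⟨α, maps_star.2 h1⟩, γ, h2⟩
    rw [hF] at hβ
    simp only [Set.mem_iUnion, exists_prop] at hβ
    obtain ⟨ε, hε, δ, hδ, rfl⟩ := hβ
    obtain ⟨h3, h4⟩ := g.maps_comp (hpre ε hε)
    exact ⟨ε, hε, δ, h3.trans hδ, (h4 δ (h3.trans hδ) hδ).injective h1⟩
  · rintro ⟨ε, hε, h⟩
    have hε' : ε ∈ (star g).dom ∩ f.dom := by
      rw [hF]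
      exact Set.mem_biUnion hε (self_mem_ideal ε)
    obtain ⟨γ, hγ⟩ := hε'.2
    exact mem_dom_of_mem_ideal ⟨γ, maps_mul.2 ⟨ε, hpre ε hε, hγ⟩⟩ h

theorem ZM.dom_tau (α : Arrow V) : (tau α).dom = ideal (Arrow.mk (𝟙 α.left)) := by
  ext β
  constructor
  · rintro ⟨γ, h⟩
    obtain ⟨h', rfl⟩ := maps_tau.1 h
    exact mem_ideal_id h'.symm
  · intro h
    exact ⟨comp α β (right_eq_of_mem_ideal h).symm, maps_tau.2 ⟨_, rfl⟩⟩

theorem ZM.dom_star_tau (α : Arrow V) : (star (tau α)).dom = ideal α := by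
  ext γ
  constructor
  · rintro ⟨β, h⟩
    obtain ⟨h, rfl⟩ := maps_tau.1 (maps_star.1 h)
    exact comp_mem_ideal _ _ _
  · rintro ⟨β, h, rfl⟩
    exact ⟨β, maps_star.2 (maps_tau.2 ⟨h, rfl⟩)⟩

theorem ZM.finGen_dom (hV : FinitelyAligned V) (f : ZM V) : FinGen f.dom := by
  -- The product step needs the range of one factor as well as the domain of the other, so both are
  -- carried through the induction.
  suffices h : FinGen f.dom ∧ FinGen (star f).dom from h.1
  induction f using ZM.induction_maps with
  | zero =>
    have h : (0 : ZM V).dom = ∅ := by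
      ext β
      simp only [Set.mem_empty_iff_false, iff_false]
      rintro ⟨γ, h⟩
      exact not_maps_zero h
    have h' : (star (0 : ZM V)).dom = ∅ := by
      ext β
      simp only [Set.mem_empty_iff_false, iff_false]
      rintro ⟨γ, h⟩
      exact not_maps_zero (maps_star.1 h)
    rw [h, h']
    exact ⟨⟨∅, by simp⟩, ⟨∅, by simp⟩⟩
  | tau α =>
    rw [dom_tau, dom_star_tau]
    exact ⟨finGen_ideal _, finGen_ideal _⟩
  | star f ih =>
    rw [star_star]
    exact ⟨ih.2, ih.1⟩
  | mul f g ihf ihg =>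
    rw [star_mul]
    refine ⟨finGen_dom_mul hV ihf.1 ihg.2, finGen_dom_mul hV ihg.2 ?_⟩
    rw [star_star]
    exact ihf.1

/-! ### Idempotents -/

theorem ZM.Maps.eq_of_idem {e : ZM V} (he : e * e = e) {β γ : Arrow V} (h : e.Maps β γ) :
    β = γ :=
  LCSC.eq_of_idem e.1 (congrArg Subtype.val he) h

theorem ZM.maps_self_of_mem_dom {e : ZM V} (he : e * e = e) {β : Arrow V} (h : β ∈ e.dom) :
    e.Maps β β := by
  obtain ⟨γ, h⟩ := h
  have := h.eq_of_idem he
  subst this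
  exact h

/-- Idempotents are partial identities. Computations in their semilattice thus become intersections
and inclusions of right ideals. -/
theorem ZM.idem_ext {e f : ZM V} (he : e * e = e) (hf : f * f = f) (h : e.dom = f.dom) :
    e = f := by
  refine ext_maps fun β γ => ⟨fun h1 => ?_, fun h1 => ?_⟩
  · have := h1.eq_of_idem he
    subst this
    exact maps_self_of_mem_dom hf (h ▸ ⟨_, h1⟩)
  · have := h1.eq_of_idem hf
    subst this
    exact maps_self_of_mem_dom he (h ▸ ⟨_, h1⟩)

theorem ZM.star_of_idem {e : ZM V} (he : e * e = e) : star e = e := by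
  refine ext_maps fun β γ => ?_
  rw [maps_star]
  constructor <;> intro h <;> have := h.eq_of_idem he <;> subst this <;> exact h

theorem ZM.mul_idem {e f : ZM V} (he : e * e = e) (hf : f * f = f) : e * f * (e * f) = e * f := by
  rw [mul_assoc, ← mul_assoc f, InverseSemigroupWithZero.idem_comm f e hf he, mul_assoc e f f,
    hf, ← mul_assoc, he]

theorem ZM.dom_mul_idem {e f : ZM V} (he : e * e = e) (hf : f * f = f) :
    (e * f).dom = e.dom ∩ f.dom := by
  ext β
  constructor
  · rintro ⟨γ, h⟩
    obtain ⟨δ, h1, h2⟩ := maps_mul.1 h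
    have := h1.eq_of_idem hf
    subst this
    exact ⟨⟨_, h2⟩, _, h1⟩
  · rintro ⟨h1, h2⟩
    exact ⟨β, maps_mul.2 ⟨β, maps_self_of_mem_dom hf h2, maps_self_of_mem_dom he h1⟩⟩

theorem ZM.ne_zero_iff_dom {f : ZM V} : f ≠ 0 ↔ f.dom.Nonempty := ne_zero_iff

theorem ZM.mul_star_idem (f : ZM V) : f * star f * (f * star f) = f * star f := by
  rw [← mul_assoc, InverseSemigroupWithZero.mul_star_mul]

theorem ZM.mul_eq_left_iff {e f : ZM V} (he : e * e = e) (hf : f * f = f) :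
    e * f = e ↔ e.dom ⊆ f.dom := by
  constructor
  · intro h
    rw [← h, dom_mul_idem he hf]
    exact Set.inter_subset_right
  · intro h
    refine idem_ext (mul_idem he hf) he ?_
    rw [dom_mul_idem he hf, Set.inter_eq_left.2 h]

/-- The idempotent `τ_α τ_α*`, the identity map of `α𝒞`. -/
noncomputable def idem (α : Arrow V) : ZM V := tau α * star (tau α)

theorem idem_mul_idem (α : Arrow V) : idem α * idem α = idem α := ZM.mul_star_idem _

theorem ZM.dom_mul_star (f : ZM V) : (f * star f).dom = (star f).dom := by
  ext β
  constructor
  · rintro ⟨γ, h⟩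
    obtain ⟨δ, h1, h2⟩ := maps_mul.1 h
    exact ⟨δ, h1⟩
  · rintro ⟨γ, h⟩
    exact ⟨β, maps_mul.2 ⟨γ, h, maps_star.1 h⟩⟩

theorem dom_idem (α : Arrow V) : (idem α).dom = ideal α :=
  (ZM.dom_mul_star _).trans (ZM.dom_star_tau _)

theorem star_tau_mul_tau (α : Arrow V) : star (tau α) * tau α = tau (Arrow.mk (𝟙 α.left)) := by
  refine ZM.ext_maps fun β γ => ?_
  rw [ZM.maps_mul]
  constructor
  · rintro ⟨δ, h1, h2⟩
    have := h1.injective (ZM.maps_star.1 h2)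
    subst this
    obtain ⟨h, rfl⟩ := ZM.maps_tau.1 h1
    refine ZM.maps_tau.2 ⟨h, ?_⟩
    simp [comp]
  · intro h1
    obtain ⟨h, rfl⟩ := ZM.maps_tau.1 h1
    have : comp (Arrow.mk (𝟙 α.left)) β h = β := by simp [comp]
    rw [this]
    have hm : (tau α).Maps β (comp α β h) := ZM.maps_tau.2 ⟨h, rfl⟩
    exact ⟨_, hm, ZM.maps_star.2 hm⟩

theorem tau_mul_tau (α β : Arrow V) (h : α.left = β.right) :
    tau α * tau β = tau (comp α β h) := by
  refine ZM.ext_maps fun γ δ => ?_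
  rw [ZM.maps_mul]
  constructor
  · rintro ⟨ε, h1, h2⟩
    obtain ⟨h3, rfl⟩ := ZM.maps_tau.1 h1
    obtain ⟨h4, rfl⟩ := ZM.maps_tau.1 h2
    exact ZM.maps_tau.2 ⟨h3, comp_assoc _ _ _ _ _⟩
  · intro h1
    obtain ⟨h2, rfl⟩ := ZM.maps_tau.1 h1
    exact ⟨comp β γ h2, ZM.maps_tau.2 ⟨h2, rfl⟩,
      ZM.maps_tau.2 ⟨h, (comp_assoc _ _ _ _ _).symm⟩⟩

theorem tau_id_idem (v : V) :
    tau (Arrow.mk (𝟙 v)) * tau (Arrow.mk (𝟙 v)) = tau (Arrow.mk (𝟙 v) : Arrow V) := by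
  rw [tau_mul_tau _ _ rfl]
  exact congrArg tau (comp_id (Arrow.mk (𝟙 v)))

theorem dom_tau_id (v : V) :
    (tau (Arrow.mk (𝟙 v) : Arrow V)).dom = ideal (Arrow.mk (𝟙 v)) := ZM.dom_tau _

/-- `s ≤ t` in `ZM(𝒞)` iff the map `t` extends the map `s`. -/
theorem ZM.naturalLE_iff {s t : ZM V} :
    NaturalLE s t ↔ ∀ β γ, s.Maps β γ → t.Maps β γ := by
  unfold NaturalLE
  constructor
  · intro h β γ hs
    rw [h] at hs
    obtain ⟨δ, h1, h2⟩ := maps_mul.1 hs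
    have := h2.eq_of_idem (mul_star_idem s)
    subst this
    exact h1
  · intro h
    refine ext_maps fun β γ => ?_
    rw [maps_mul]
    constructor
    · intro hs
      exact ⟨γ, h _ _ hs, maps_mul.2 ⟨β, maps_star.2 hs, hs⟩⟩
    · rintro ⟨δ, h1, h2⟩
      have := h2.eq_of_idem (mul_star_idem s)
      subst this
      obtain ⟨ε, h3, h4⟩ := maps_mul.1 h2
      have := h1.injective (h _ _ h4)
      subst this
      exact h4

end ZigzagElements

/-! ### Joins of commuting projections as polynomials -/

section JoinList

/-- The join `p₁ ∨ ⋯ ∨ pₙ` of a list of commuting idempotents of a ring. -/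
def joinList {R : Type*} [NonUnitalRing R] : List R → R
  | [] => 0
  | p :: l => p + joinList l - p * joinList l

variable {R : Type*} [NonUnitalRing R]

theorem joinList_mul_eq_zero {l : List R} {y : R} (h : ∀ p ∈ l, p * y = 0) :
    joinList l * y = 0 := by
  induction l with
  | nil => simp [joinList]
  | cons p l ih =>
    have h1 := ih fun q hq => h q (List.mem_cons_of_mem _ hq)
    rw [joinList, sub_mul, add_mul, mul_assoc, h1, h p List.mem_cons_self]
    simp

theorem joinList_mul_eq_self {l : List R} {r : R} (h : ∀ p ∈ l, p * r = p) :
    joinList l * r = joinList l := by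
  induction l with
  | nil => simp [joinList]
  | cons p l ih =>
    have h1 := ih fun q hq => h q (List.mem_cons_of_mem _ hq)
    rw [joinList, sub_mul, add_mul, mul_assoc, h1, h p List.mem_cons_self]

theorem commute_joinList {l : List R} {a : R} (h : ∀ p ∈ l, Commute a p) :
    Commute a (joinList l) := by
  induction l with
  | nil => exact Commute.zero_right a
  | cons p l ih =>
    have h1 := ih fun q hq => h q (List.mem_cons_of_mem _ hq)
    have h2 := h p List.mem_cons_self
    exact (h2.add_right h1).sub_right (h2.mul_right h1)

theorem mul_joinList_of_mem {l : List R} (hc : ∀ p ∈ l, ∀ q ∈ l, Commute p q)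
    (hi : ∀ p ∈ l, p * p = p) {p : R} (hp : p ∈ l) : p * joinList l = p := by
  induction l with
  | nil => simp at hp
  | cons a l ih =>
    rcases List.mem_cons.1 hp with rfl | hp'
    · rw [joinList, mul_sub, mul_add, ← mul_assoc, hi p hp]
      abel
    · have h1 := ih (fun q hq r hr => hc q (List.mem_cons_of_mem _ hq) r (List.mem_cons_of_mem _ hr))
        (fun q hq => hi q (List.mem_cons_of_mem _ hq)) hp'
      have h2 : Commute p a := hc p hp a List.mem_cons_self
      rw [joinList, mul_sub, mul_add, h1, ← mul_assoc, h2.eq, mul_assoc, h1]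
      abel

/-- This transports join relations along homomorphisms, although an abstract least upper bound need
not be preserved by them. -/
theorem map_joinList {S F : Type*} [NonUnitalRing S] [FunLike F R S] [NonUnitalRingHomClass F R S]
    (f : F) (l : List R) : f (joinList l) = joinList (l.map f) := by
  induction l with
  | nil => simp [joinList]
  | cons p l ih => simp [joinList, ih]

end JoinList

section ProjectionJoins

variable {B : Type*} [NonUnitalCStarAlgebra B]

theorem IsProjJoin.unique {P : Set B} {q r : B} (hq : IsProjJoin P q) (hr : IsProjJoin P r) :
    q = r := by
  have h1 := hq.2.2 r hr.1 hr.2.1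
  have h2 := hr.2.2 q hq.1 hq.2.1
  calc q = star q := hq.1.isSelfAdjoint.star_eq.symm
    _ = star (q * r) := by rw [← h1]
    _ = r * q := by rw [star_mul, hq.1.isSelfAdjoint.star_eq, hr.1.isSelfAdjoint.star_eq]
    _ = r := h2.symm

theorem isProjJoin_joinList {l : List B} (hc : ∀ p ∈ l, ∀ q ∈ l, Commute p q)
    (hp : ∀ p ∈ l, IsStarProjection p) : IsProjJoin {p | p ∈ l} (joinList l) := by
  have hle : ∀ p ∈ l, p * joinList l = p := fun p hpl =>
    mul_joinList_of_mem hc (fun p hp' => (hp p hp').isIdempotentElem) hpl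
  refine ⟨⟨joinList_mul_eq_self hle, ?_⟩, fun p hpl => (hle p hpl).symm, fun r _ h =>
    (joinList_mul_eq_self fun p hp => (h p hp).symm).symm⟩
  clear hle
  induction l with
  | nil => simp [joinList]
  | cons p l ih =>
    have h1 := ih (fun q hq r hr => hc q (List.mem_cons_of_mem _ hq) r (List.mem_cons_of_mem _ hr))
        (fun q hq => hp q (List.mem_cons_of_mem _ hq))
    have h2 : Commute p (joinList l) := commute_joinList fun q hq =>
      hc p List.mem_cons_self q (List.mem_cons_of_mem _ hq)
    have h3 := (hp p List.mem_cons_self).isSelfAdjoint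
    rw [isSelfAdjoint_iff] at h1 h3 ⊢
    rw [joinList, star_sub, star_add, star_mul, h1, h3, h2.eq]

/-- The join of the image of a finite set under a map into commuting projections. -/
theorem isProjJoin_image {ι : Type*} (F : Finset ι) (p : ι → B)
    (hc : ∀ i ∈ F, ∀ j ∈ F, Commute (p i) (p j)) (hp : ∀ i ∈ F, IsStarProjection (p i)) :
    IsProjJoin (p '' (F : Set ι)) (joinList (F.toList.map p)) := by
  have h := isProjJoin_joinList (l := F.toList.map p)
    (by
      simp only [List.mem_map, Finset.mem_toList]
      rintro _ ⟨i, hi, rfl⟩ _ ⟨j, hj, rfl⟩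
      exact hc i hi j hj)
    (by
      simp only [List.mem_map, Finset.mem_toList]
      rintro _ ⟨i, hi, rfl⟩
      exact hp i hi)
  have hset : p '' (F : Set ι) = {q | q ∈ F.toList.map p} := by
    ext q
    simp
  rwa [hset]

/-- The least upper bound property only compares `q` with projections, while `y` is arbitrary. The
polynomial formula for the join bridges this, as each of its terms ends in some `p i` up to
commutation. -/
theorem IsProjJoin.mul_eq_zero {ι : Type*} {F : Finset ι} {p : ι → B}
    (hc : ∀ i ∈ F, ∀ j ∈ F, Commute (p i) (p j)) (hp : ∀ i ∈ F, IsStarProjection (p i))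
    {q : B} (hq : IsProjJoin (p '' (F : Set ι)) q) {y : B} (hy : ∀ i ∈ F, p i * y = 0) :
    q * y = 0 := by
  rw [hq.unique (isProjJoin_image F p hc hp)]
  refine joinList_mul_eq_zero ?_
  simp only [List.mem_map, Finset.mem_toList]
  rintro _ ⟨i, hi, rfl⟩
  exact hy i hi

end ProjectionJoins

/-! ### Range projections of a representation -/

section Representations

variable {V : Type u} [Category.{v} V] {B : Type w} [NonUnitalCStarAlgebra B] {T : Arrow V → B}

namespace IsRepresentation

variable (hT : IsRepresentation T)
include hT

theorem star_id (v : V) : star (T (Arrow.mk (𝟙 v))) = T (Arrow.mk (𝟙 v)) := by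
  have h := hT.star_mul_self (Arrow.mk (𝟙 v))
  change _ = T (Arrow.mk (𝟙 v)) at h
  rw [← h, star_mul, star_star]

theorem mul_id (α : Arrow V) : T α * T (Arrow.mk (𝟙 α.left)) = T α := by
  rw [hT.mul _ _ rfl, comp_id]

theorem id_mul_star (α : Arrow V) : T (Arrow.mk (𝟙 α.left)) * star (T α) = star (T α) := by
  rw [← hT.star_id, ← star_mul, hT.mul_id]

theorem mul_star_mul (α : Arrow V) : T α * star (T α) * T α = T α := by
  rw [mul_assoc, hT.star_mul_self, hT.mul_id]

theorem star_mul_mul_star (α : Arrow V) : star (T α) * (T α * star (T α)) = star (T α) := by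
  rw [← mul_assoc, hT.star_mul_self, hT.id_mul_star]

theorem isStarProjection (α : Arrow V) : IsStarProjection (T α * star (T α)) := by
  refine ⟨?_, ?_⟩
  · change T α * star (T α) * (T α * star (T α)) = _
    rw [← mul_assoc, hT.mul_star_mul]
  · rw [isSelfAdjoint_iff, star_mul, star_star]

theorem star_mul_eq_zero_iff {α : Arrow V} {y : B} :
    T α * star (T α) * y = 0 ↔ star (T α) * y = 0 := by
  constructor
  · intro h
    rw [← hT.star_mul_mul_star, mul_assoc, h, mul_zero]
  · intro h
    rw [mul_assoc, h, mul_zero]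

/-- By condition (3) the product of the two projections is itself a projection, hence self-adjoint,
which forces the factors to commute. -/
theorem commute (hV : FinitelyAligned V) (α β : Arrow V) :
    Commute (T α * star (T α)) (T β * star (T β)) := by
  obtain ⟨L, hL⟩ := hV.exists_isVee α β
  have h := (hT.range_mul_range α β L hL).1.isSelfAdjoint
  exact ((hT.isStarProjection α).isSelfAdjoint.commute_iff
    (hT.isStarProjection β).isSelfAdjoint).2 h

/-- Condition (3) as a vanishing criterion, free of the choice of `α ∨ β`. -/
theorem range_mul_range_mul_eq_zero (hV : FinitelyAligned V) {α β : Arrow V} {y : B}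
    (h : ∀ ε ∈ ideal α ∩ ideal β, star (T ε) * y = 0) :
    T α * star (T α) * (T β * star (T β)) * y = 0 := by
  obtain ⟨L, hL⟩ := hV.exists_isVee α β
  refine (hT.range_mul_range α β L hL).mul_eq_zero (fun i _ j _ => hT.commute hV i j)
    (fun i _ => hT.isStarProjection i) fun γ hγ => hT.star_mul_eq_zero_iff.2 (h γ ?_)
  rw [hL.2]
  exact Set.mem_biUnion hγ (self_mem_ideal γ)

end IsRepresentation

theorem IsCovariant.id_mul_eq_zero (hV : FinitelyAligned V) (hT : IsCovariant T) {v : V}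
    {F : Finset (Arrow V)} (hF : Exhaustive v F) {y : B} (h : ∀ ε ∈ F, star (T ε) * y = 0) :
    T (Arrow.mk (𝟙 v)) * y = 0 :=
  (hT.exhaustive v F hF).mul_eq_zero (fun i _ j _ => hT.toIsRepresentation.commute hV i j)
    (fun i _ => hT.toIsRepresentation.isStarProjection i)
    fun γ hγ => hT.toIsRepresentation.star_mul_eq_zero_iff.2 (h γ hγ)

end Representations

/-! ### Elements implementing zigzag maps -/

section Implementing

variable {V : Type u} [Category.{v} V] [LeftCancellative V]
  {B : Type w} [NonUnitalCStarAlgebra B] {T : Arrow V → B}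

/-- `x` acts on the elements `T β` with `β` in the domain of `f` as `f` does on the `β`, and
vanishes on the orthogonal complement of the domain of `f`. -/
structure ActsAs (T : Arrow V → B) (f : ZM V) (x : B) : Prop where
  apply : ∀ β γ, f.Maps β γ → x * T β = T γ
  annihilates : ∀ y, (∀ β ∈ f.dom, star (T β) * y = 0) → x * y = 0

/-- `x` implements the partial bijection `f`. -/
structure Implements (T : Arrow V → B) (f : ZM V) (x : B) : Prop where
  actsAs : ActsAs T f x
  actsAs_star : ActsAs T (star f) (star x)

namespace Implements

theorem star {f : ZM V} {x : B} (h : Implements T f x) : Implements T (star f) (star x) :=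
  ⟨h.actsAs_star, by rw [star_star, star_star]; exact h.actsAs⟩

/-- The difference `x - x'` kills each `T β` with `β` in the domain. Taking adjoints, `star (x -
x')` is orthogonal to these ranges, so both `x` and `x'` annihilate it, and the C*-identity gives `x
- x' = 0`. -/
theorem unique {f : ZM V} {x x' : B} (h : ActsAs T f x) (h' : ActsAs T f x') : x = x' := by
  have key : ∀ β ∈ f.dom, Star.star (T β) * Star.star (x - x') = 0 := by
    rintro β ⟨γ, hβ⟩
    rw [← star_mul, sub_mul, h.apply _ _ hβ, h'.apply _ _ hβ, sub_self, star_zero]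
  have h1 : (x - x') * Star.star (x - x') = 0 := by
    rw [sub_mul, h.annihilates _ key, h'.annihilates _ key, sub_zero]
  rw [CStarRing.mul_star_self_eq_zero_iff, sub_eq_zero] at h1
  exact h1

theorem star_apply_mul {f : ZM V} {x : B} (h : Implements T f x) {β γ : Arrow V}
    (hm : f.Maps β γ) : Star.star (T γ) * x = Star.star (T β) := by
  rw [← h.actsAs_star.apply γ β (ZM.maps_star.2 hm), star_mul, star_star]

theorem zero : Implements T (0 : ZM V) 0 := by
  refine ⟨⟨fun β γ h => (ZM.not_maps_zero h).elim, fun y _ => zero_mul y⟩,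
    ⟨fun β γ h => (ZM.not_maps_zero (ZM.maps_star.1 h)).elim, fun y _ => ?_⟩⟩
  rw [star_zero, zero_mul]

theorem tau (hT : IsRepresentation T) (α : Arrow V) : Implements T (tau α) (T α) := by
  refine ⟨⟨?_, fun y h => ?_⟩, ⟨?_, fun y h => ?_⟩⟩
  · intro β γ h
    obtain ⟨h', rfl⟩ := ZM.maps_tau.1 h
    exact hT.mul _ _ _
  · have h1 := h (Arrow.mk (𝟙 α.left)) (by rw [ZM.dom_tau]; exact self_mem_ideal _)
    rw [hT.star_id] at h1
    rw [← hT.mul_id, mul_assoc, h1, mul_zero]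
  · intro γ β h
    obtain ⟨h', rfl⟩ := ZM.maps_tau.1 (ZM.maps_star.1 h)
    rw [← hT.mul _ _ h', ← mul_assoc, hT.star_mul_self, hT.mul (Arrow.mk (𝟙 α.left)) β h']
    congr 1
    simp [comp]
  · exact h α (by rw [ZM.dom_star_tau]; exact self_mem_ideal _)

theorem actsAs_mul (hV : FinitelyAligned V) (hT : IsRepresentation T) {f g : ZM V} {x y : B}
    (hf : Implements T f x) (hg : Implements T g y) : ActsAs T (f * g) (x * y) := by
  refine ⟨?_, fun z hz => ?_⟩
  · intro α γ h
    obtain ⟨β, h1, h2⟩ := ZM.maps_mul.1 h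
    rw [mul_assoc, hg.actsAs.apply _ _ h1, hf.actsAs.apply _ _ h2]
  · rw [mul_assoc]
    refine hf.actsAs.annihilates _ fun γ hγ => ?_
    -- On the range of `g`, the adjoint relation turns `star (T ε) * y` into `star (T δ)` with `g`
    -- sending `δ` to `ε`, and `δ` lies in the domain of `f * g`.
    have h1 : ∀ ε ∈ ideal γ, ε ∈ (Star.star g).dom → Star.star (T ε) * (y * z) = 0 := by
      rintro ε hε ⟨δ, hδ⟩
      rw [← mul_assoc, hg.star_apply_mul (ZM.maps_star.1 hδ)]
      obtain ⟨η, hη⟩ := ZM.mem_dom_of_mem_ideal hγ hε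
      exact hz δ ⟨η, ZM.maps_mul.2 ⟨ε, ZM.maps_star.1 hδ, hη⟩⟩
    -- Range projections of `γ` and of `δ` in the range of `g` meet only over `γ𝒞 ∩ δ𝒞`, where `h1`
    -- applies. This is where finite alignment enters.
    have h2 : Star.star y * (T γ * Star.star (T γ) * (y * z)) = 0 := by
      refine hg.actsAs_star.annihilates _ fun δ hδ => ?_
      rw [← hT.star_mul_eq_zero_iff, ← mul_assoc]
      refine hT.range_mul_range_mul_eq_zero hV fun ε hε => ?_
      exact h1 ε hε.2 (ZM.mem_dom_of_mem_ideal hδ hε.1)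
    -- Multiplying `h2` by `star z` on the left gives `w* w = 0` for `w = star (T γ) * (y * z)`.
    have h3 : Star.star (Star.star (T γ) * (y * z)) * (Star.star (T γ) * (y * z)) = 0 := by
      rw [star_mul, star_star, star_mul]
      calc Star.star z * Star.star y * T γ * (Star.star (T γ) * (y * z))
          = Star.star z * (Star.star y * (T γ * Star.star (T γ) * (y * z))) := by
            simp only [mul_assoc]
        _ = 0 := by rw [h2, mul_zero]
    exact CStarRing.star_mul_self_eq_zero_iff _ |>.1 h3

theorem mul (hV : FinitelyAligned V) (hT : IsRepresentation T) {f g : ZM V} {x y : B}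
    (hf : Implements T f x) (hg : Implements T g y) : Implements T (f * g) (x * y) := by
  refine ⟨actsAs_mul hV hT hf hg, ?_⟩
  rw [star_mul, star_mul]
  exact actsAs_mul hV hT hg.star hf.star

theorem exists_implements (hV : FinitelyAligned V) (hT : IsRepresentation T) (f : ZM V) :
    ∃ x, Implements T f x := by
  induction f using ZM.induction_maps with
  | zero => exact ⟨0, zero⟩
  | tau α => exact ⟨_, tau hT α⟩
  | star f ih => exact ⟨_, ih.choose_spec.star⟩
  | mul f g ihf ihg => exact ⟨_, mul hV hT ihf.choose_spec ihg.choose_spec⟩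

end Implements

theorem IsSemigroupRep.eq_of_tau {π ρ : ZM V → B} (hπ : IsSemigroupRep π) (hρ : IsSemigroupRep ρ)
    (h : ∀ α, π (tau α) = ρ (tau α)) : π = ρ := by
  funext f
  induction f using ZM.induction_maps with
  | zero => rw [hπ.map_zero, hρ.map_zero]
  | tau α => exact h α
  | star f ih => rw [hπ.map_star, hρ.map_star, ih]
  | mul f g ihf ihg => rw [hπ.map_mul, hρ.map_mul, ihf, ihg]

theorem IsAssociated.unique {π ρ : ZM V → B} (hπ : IsAssociated T π) (hρ : IsAssociated T ρ) :
    π = ρ :=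
  hπ.1.eq_of_tau hρ.1 fun α => (hπ.2 α).trans (hρ.2 α).symm

/-- Any choice of implementing elements works: both sides of each required identity implement the
same zigzag map. -/
theorem IsRepresentation.exists_isAssociated (hV : FinitelyAligned V) (hT : IsRepresentation T) :
    ∃ π : ZM V → B, IsAssociated T π := by
  choose π hπ using Implements.exists_implements hV hT
  refine ⟨π, ⟨fun s t => ?_, fun s => ?_, ?_⟩, fun α => ?_⟩
  · exact Implements.unique (hπ _).actsAs ((hπ s).mul hV hT (hπ t)).actsAs
  · exact Implements.unique (hπ _).actsAs (hπ s).star.actsAs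
  · exact Implements.unique (hπ _).actsAs Implements.zero.actsAs
  · exact Implements.unique (hπ _).actsAs (Implements.tau hT α).actsAs

theorem IsAssociated.implements (hV : FinitelyAligned V) (hT : IsRepresentation T) {π : ZM V → B}
    (hπ : IsAssociated T π) (f : ZM V) : Implements T f (π f) := by
  induction f using ZM.induction_maps with
  | zero => rw [hπ.1.map_zero]; exact .zero
  | tau α => rw [hπ.2]; exact .tau hT α
  | star f ih => rw [hπ.1.map_star]; exact ih.star
  | mul f g ihf ihg => rw [hπ.1.map_mul]; exact ihf.mul hV hT ihg

end Implementing

/-! ### Semigroup representations and dense subsets of ideals -/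

section SemigroupReps

variable {V : Type u} [Category.{v} V] [LeftCancellative V]
  {B : Type w} [NonUnitalCStarAlgebra B] {T : Arrow V → B} {π : ZM V → B}

theorem IsSemigroupRep.isStarProjection (hπ : IsSemigroupRep π) {e : ZM V} (he : e * e = e) :
    IsStarProjection (π e) := by
  refine ⟨?_, ?_⟩
  · change π e * π e = π e
    rw [← hπ.map_mul, he]
  · rw [isSelfAdjoint_iff, ← hπ.map_star, ZM.star_of_idem he]

theorem IsSemigroupRep.commute (hπ : IsSemigroupRep π) {e f : ZM V} (he : e * e = e)
    (hf : f * f = f) : Commute (π e) (π f) := by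
  change π e * π f = π f * π e
  rw [← hπ.map_mul, ← hπ.map_mul, InverseSemigroupWithZero.idem_comm e f he hf]

theorem IsSemigroupRep.map_idem (hπ : IsSemigroupRep π) (α : Arrow V) :
    π (idem α) = π (tau α) * star (π (tau α)) := by
  rw [idem, hπ.map_mul, hπ.map_star]

theorem IsAssociated.map_idem (hπ : IsAssociated T π) (α : Arrow V) :
    π (idem α) = T α * star (T α) := by
  rw [hπ.1.map_idem, hπ.2]

theorem IsSemigroupRep.isPartialIsometry (hπ : IsSemigroupRep π) (s : ZM V) :
    IsPartialIsometry (π s) := by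
  unfold IsPartialIsometry
  rw [← hπ.map_star, ← hπ.map_mul, ← hπ.map_mul, InverseSemigroupWithZero.mul_star_mul]

/-- A covariant representation sees only a dense part of each principal right ideal. -/
theorem IsCovariant.star_mul_eq_zero (hV : FinitelyAligned V) (hT : IsCovariant T) {β : Arrow V}
    (G : Finset (ZM V)) (hG : ∀ α ∈ ideal β, ∃ f ∈ G, ∃ δ ∈ ideal α, δ ∈ f.dom) {y : B}
    (hy : ∀ ε ∈ ideal β, (∃ f ∈ G, ε ∈ f.dom) → star (T ε) * y = 0) : star (T β) * y = 0 := by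
  classical
  choose gen hgen using ZM.finGen_dom (V := V) hV
  have hmem : ∀ ε, (∃ f ∈ G, ε ∈ (f * tau β).dom) ↔
      ∃ f ∈ G, ∃ h : β.left = ε.right, comp β ε h ∈ f.dom := by
    intro ε
    constructor
    · rintro ⟨f, hf, γ, hm⟩
      obtain ⟨δ, h1, h2⟩ := ZM.maps_mul.1 hm
      obtain ⟨h, rfl⟩ := ZM.maps_tau.1 h1
      exact ⟨f, hf, h, γ, h2⟩
    · rintro ⟨f, hf, h, γ, hm⟩
      exact ⟨f, hf, γ, ZM.maps_mul.2 ⟨_, ZM.maps_tau.2 ⟨h, rfl⟩, hm⟩⟩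
  have hF : ∀ ε ∈ G.biUnion fun f => gen (f * tau β),
      ∃ f ∈ G, ∃ h : β.left = ε.right, comp β ε h ∈ f.dom := by
    intro ε hε
    obtain ⟨f, hf, hε⟩ := Finset.mem_biUnion.1 hε
    refine (hmem ε).1 ⟨f, hf, ?_⟩
    rw [hgen]
    exact Set.mem_biUnion hε (self_mem_ideal ε)
  -- The maps `f * tau β` have as domains the pullbacks of the domains of `f` along `τ_β`. Density
  -- in `β𝒞` becomes exhaustiveness of their generators at `s(β)`.
  have hex : Exhaustive β.left (G.biUnion fun f => gen (f * tau β)) := by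
    refine ⟨fun ε hε => ?_, fun α hα => ?_⟩
    · obtain ⟨f, _, h, _⟩ := hF ε hε
      exact h.symm
    · obtain ⟨f, hf, δ, hδ, hm⟩ := hG _ (comp_mem_ideal β α hα.symm)
      obtain ⟨η, hη, rfl⟩ := hδ
      have hη' : α.left = η.right := hη
      rw [comp_assoc _ _ _ _ hη'] at hm
      have h1 : comp α η hη' ∈ (f * tau β).dom := by
        obtain ⟨γ, hm⟩ := hm
        exact ⟨γ, ZM.maps_mul.2 ⟨_, ZM.maps_tau.2 ⟨_, rfl⟩, hm⟩⟩
      rw [hgen] at h1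
      simp only [Set.mem_iUnion, exists_prop] at h1
      obtain ⟨ε, hε, h1⟩ := h1
      exact ⟨ε, Finset.mem_biUnion.2 ⟨f, hf, hε⟩, _, comp_mem_ideal _ _ _, h1⟩
  -- Applied to `star (T β) * y`, because `star (T ε) * star (T β)` is the adjoint of `T` at `βε`.
  have h := hT.id_mul_eq_zero hV hex (y := star (T β) * y) fun ε hε => by
    obtain ⟨f, hf, h, hm⟩ := hF ε hε
    rw [← mul_assoc, ← star_mul, hT.mul _ _ h]
    exact hy _ (comp_mem_ideal _ _ _) ⟨f, hf, hm⟩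
  rwa [← mul_assoc, hT.toIsRepresentation.id_mul_star] at h

end SemigroupReps

/-! ### Covariance and tightness -/

section ListProducts

variable {R : Type*} [Ring R]

theorem mul_list_prod_eq_zero {l : List R} {a : R} (hc : ∀ p ∈ l, Commute a p)
    (h : ∃ p ∈ l, a * p = 0) : a * l.prod = 0 := by
  induction l with
  | nil => simp at h
  | cons p l ih =>
    rw [List.prod_cons]
    obtain ⟨q, hq, h⟩ := h
    rcases List.mem_cons.1 hq with rfl | hq
    · rw [← mul_assoc, h, zero_mul]
    · rw [← mul_assoc, (hc p List.mem_cons_self).eq, mul_assoc,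
        ih (fun r hr => hc r (List.mem_cons_of_mem _ hr)) ⟨q, hq, h⟩, mul_zero]

theorem mul_list_prod_eq_self {l : List R} {a : R} (h : ∀ p ∈ l, a * p = a) :
    a * l.prod = a := by
  induction l with
  | nil => simp
  | cons p l ih =>
    rw [List.prod_cons, ← mul_assoc, h p List.mem_cons_self,
      ih fun r hr => h r (List.mem_cons_of_mem _ hr)]

theorem list_prod_mul_eq_self {l : List R} {a : R} (h : ∀ p ∈ l, p * a = a) :
    l.prod * a = a := by
  induction l with
  | nil => simp
  | cons p l ih =>
    rw [List.prod_cons, mul_assoc, ih fun r hr => h r (List.mem_cons_of_mem _ hr),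
      h p List.mem_cons_self]

end ListProducts

section Tightness

variable {V : Type u} [Category.{v} V] [LeftCancellative V]
  {B : Type w} [NonUnitalCStarAlgebra B] {T : Arrow V → B} {π : ZM V → B}

/-- The factor `π e` keeps the product in the image of `π` even for empty `X`, when the product is
the unit of the unitization. -/
theorem IsSemigroupRep.exists_prod_mul (hπ : IsSemigroupRep π) (X : List (ZM V))
    (hX : ∀ x ∈ X, x * x = x) {e : ZM V} (he : e * e = e) :
    ∃ f : ZM V, f * f = f ∧ (∀ x ∈ X, f.dom ⊆ x.dom) ∧
      (X.map fun x => (π x : Unitization ℂ B)).prod * (π e : Unitization ℂ B) = (π f : B) := by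
  induction X with
  | nil => exact ⟨e, he, by simp, by simp⟩
  | cons x X ih =>
    obtain ⟨f, hf, h1, h2⟩ := ih fun y hy => hX y (List.mem_cons_of_mem _ hy)
    have hx := hX x List.mem_cons_self
    refine ⟨x * f, ZM.mul_idem hx hf, ?_, ?_⟩
    · rw [ZM.dom_mul_idem hx hf]
      intro y hy
      rcases List.mem_cons.1 hy with rfl | hy
      · exact Set.inter_subset_left
      · exact Set.inter_subset_right.trans (h1 y hy)
    · rw [List.map_cons, List.prod_cons, mul_assoc, h2, hπ.map_mul, Unitization.inr_mul]

theorem exists_coe_eq_prod_one_sub_mul {ι : Type*} (p : ι → B) (l : List ι) (b : B) :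
    ∃ c : B, (l.map fun i => 1 - (p i : Unitization ℂ B)).prod * (b : Unitization ℂ B) = c := by
  induction l with
  | nil => exact ⟨b, by simp⟩
  | cons i l ih =>
    obtain ⟨c, hc⟩ := ih
    refine ⟨c - p i * c, ?_⟩
    rw [List.map_cons, List.prod_cons, mul_assoc, hc, sub_mul, one_mul, Unitization.inr_sub,
      Unitization.inr_mul]

/-- With `q` the join of `π(Z)` and `c` the product of the `1 - π y` applied to `π s`, the claim
becomes that the product over `X` kills `c - q * c`. Over `X`, every ideal meets the domain of some
`y ∈ Y` or of some `z ∈ Z`. The element `c` vanishes under the former and `1 - q` under the latter,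
and covariance extends the vanishing from this dense part. -/
theorem IsCovariant.isTight (hV : FinitelyAligned V) (hT : IsCovariant T)
    (hπ : IsAssociated T π) : IsTight π := by
  classical
  intro X Y Z hX hY hZ
  have hR := hT.toIsRepresentation
  have hZi : ∀ z ∈ Z, z * z = z := fun z hz => (hZ.1 hz).1
  have hq : IsProjJoin (π '' (Z : Set (ZM V))) (joinList (Z.toList.map π)) :=
    isProjJoin_image Z π (fun i hi j hj => hπ.1.commute (hZi i hi) (hZi j hj))
      (fun i hi => hπ.1.isStarProjection (hZi i hi))
  have hcq : ∀ e : ZM V, e * e = e → Commute (π e) (joinList (Z.toList.map π)) := by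
    intro e he
    refine commute_joinList ?_
    simp only [List.mem_map, Finset.mem_toList]
    rintro _ ⟨z, hz, rfl⟩
    exact hπ.1.commute he (hZi z hz)
  have hqX : ∀ x ∈ X, joinList (Z.toList.map π) * π x = joinList (Z.toList.map π) := by
    intro x hx
    refine joinList_mul_eq_self ?_
    simp only [List.mem_map, Finset.mem_toList]
    rintro _ ⟨z, hz, rfl⟩
    rw [← hπ.1.map_mul, (hZ.1 hz).2.1 x hx]
  have hqY : ∀ y ∈ Y, joinList (Z.toList.map π) * π y = 0 := by
    intro y hy
    refine joinList_mul_eq_zero ?_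
    simp only [List.mem_map, Finset.mem_toList]
    rintro _ ⟨z, hz, rfl⟩
    rw [← hπ.1.map_mul, (hZ.1 hz).2.2 y hy, hπ.1.map_zero]
  generalize joinList (Z.toList.map π) = q at *
  refine ⟨q, hq, fun s => ?_⟩
  have hcU : ∀ {a b : B}, Commute a b → Commute (a : Unitization ℂ B) (b : Unitization ℂ B) := by
    intro a b h
    change _ * _ = _ * _
    rw [← Unitization.inr_mul, h.eq, Unitization.inr_mul]
  obtain ⟨c, hc⟩ := exists_coe_eq_prod_one_sub_mul π Y (π s)
  generalize hN : (Y.map fun y => 1 - (π y : Unitization ℂ B)).prod = N at *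
  have hNc : ∀ e : ZM V, e * e = e → Commute (π e : Unitization ℂ B) N := by
    intro e he
    rw [← hN]
    refine Commute.list_prod_right _ _ ?_
    simp only [List.mem_map]
    rintro _ ⟨y, hy, rfl⟩
    exact (Commute.one_right _).sub_right (hcU (hπ.1.commute he (hY y hy)))
  have hqN : (q : Unitization ℂ B) * N = q := by
    rw [← hN]
    refine mul_list_prod_eq_self ?_
    simp only [List.mem_map]
    rintro _ ⟨y, hy, rfl⟩
    rw [mul_sub, mul_one, ← Unitization.inr_mul, hqY y hy, Unitization.inr_zero, sub_zero]
  have hXq : (X.map fun x => (π x : Unitization ℂ B)).prod * q = q := by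
    refine list_prod_mul_eq_self ?_
    simp only [List.mem_map]
    rintro _ ⟨x, hx, rfl⟩
    rw [← Unitization.inr_mul, (hcq x (hX x hx)).eq, hqX x hx]
  have hqc : q * c = q * π s := by
    apply Unitization.inr_injective (R := ℂ)
    rw [Unitization.inr_mul, ← hc, ← mul_assoc, hqN, Unitization.inr_mul]
  have hsc : π (s * star s) * c = c := by
    apply Unitization.inr_injective (R := ℂ)
    rw [Unitization.inr_mul, ← hc, ← mul_assoc, (hNc _ (ZM.mul_star_idem s)).eq, mul_assoc,
      ← Unitization.inr_mul, ← hπ.1.map_mul, InverseSemigroupWithZero.mul_star_mul]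
  have hscq : π (s * star s) * (c - q * c) = c - q * c := by
    rw [mul_sub, ← mul_assoc, (hcq _ (ZM.mul_star_idem s)).eq, mul_assoc, hsc]
  -- Since `c - q * c` is fixed by `π (s * star s)`, the product over `X` acts on it as `π e`.
  obtain ⟨e, he, heX, hXe⟩ := hπ.1.exists_prod_mul X hX (ZM.mul_star_idem s)
  have key : π e * (c - q * c) = 0 := by
    refine (hπ.implements hV hR e).actsAs.annihilates _ fun δ hδ => ?_
    refine hT.star_mul_eq_zero hV (Z ∪ Y.toFinset) (fun α hα => ?_) ?_
    -- If `α𝒞` misses the domains of all `y ∈ Y`, then `idem α` is a nonzero element of `E^{X,Y}`,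
    -- so the cover `Z` meets it.
    · by_cases h : ∃ y ∈ Y, ∃ δ' ∈ ideal α, δ' ∈ y.dom
      · obtain ⟨y, hy, h⟩ := h
        exact ⟨y, by simp [hy], h⟩
      · push Not at h
        have h1 : idem α ∈ idemBetween X Y := by
          refine ⟨idem_mul_idem α, fun x hx => ?_, fun y hy => ?_⟩
          · rw [ZM.mul_eq_left_iff (idem_mul_idem α) (hX x hx), dom_idem]
            exact fun ε hε => heX x hx (ZM.mem_dom_of_mem_ideal hδ (ideal_subset_ideal hα hε))
          · by_contra hne
            rw [← ne_eq, ZM.ne_zero_iff_dom, ZM.dom_mul_idem (idem_mul_idem α) (hY y hy),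
              dom_idem] at hne
            obtain ⟨ε, h1, h2⟩ := hne
            exact h y hy ε h1 h2
        have h2 : idem α ≠ 0 := by
          rw [ZM.ne_zero_iff_dom, dom_idem]
          exact ⟨α, self_mem_ideal α⟩
        obtain ⟨z, hz, h3⟩ := hZ.2 _ h1 h2
        rw [ZM.ne_zero_iff_dom, ZM.dom_mul_idem (hZi z hz) (idem_mul_idem α), dom_idem] at h3
        obtain ⟨ε, h3, h4⟩ := h3
        exact ⟨z, by simp [hz], ε, h4, h3⟩
    · rintro ε hε ⟨f, hf, hεf⟩
      have hle : ∀ f : ZM V, f * f = f → ε ∈ f.dom → π (idem ε) * π f = π (idem ε) := by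
        intro f hf hεf
        rw [← hπ.1.map_mul, (ZM.mul_eq_left_iff (idem_mul_idem ε) hf).2]
        rw [dom_idem]
        exact fun η hη => ZM.mem_dom_of_mem_ideal hεf hη
      rw [← hR.star_mul_eq_zero_iff, ← hπ.map_idem]
      rcases Finset.mem_union.1 hf with hf | hf
      · have h1 : π f = π f * q := hq.2.1 _ ⟨f, hf, rfl⟩
        have h2 : π (idem ε) * q = π (idem ε) := by
          rw [← hle f (hZi f hf) hεf, mul_assoc, ← h1]
        rw [mul_sub, ← mul_assoc, h2, sub_self]
      · have hf := List.mem_toFinset.1 hf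
        have h1 : (π (idem ε) : Unitization ℂ B) * N = 0 := by
          rw [← hN]
          refine mul_list_prod_eq_zero ?_ ?_
          · simp only [List.mem_map]
            rintro _ ⟨y, hy, rfl⟩
            exact (Commute.one_right _).sub_right
              (hcU (hπ.1.commute (idem_mul_idem ε) (hY y hy)))
          · refine ⟨_, List.mem_map.2 ⟨f, hf, rfl⟩, ?_⟩
            rw [mul_sub, mul_one, ← Unitization.inr_mul, hle f (hY f hf) hεf, sub_self]
        have h2 : π (idem ε) * c = 0 := by
          apply Unitization.inr_injective (R := ℂ)
          rw [Unitization.inr_mul, ← hc, ← mul_assoc, h1, zero_mul, Unitization.inr_zero]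
        rw [mul_sub, ← mul_assoc, (hcq _ (idem_mul_idem ε)).eq, mul_assoc, h2, mul_zero, sub_zero]
  have hXc : (X.map fun x => (π x : Unitization ℂ B)).prod * ((c - q * c : B) : Unitization ℂ B)
      = 0 := by
    rw [← hscq, Unitization.inr_mul, ← mul_assoc, hXe, ← Unitization.inr_mul, key,
      Unitization.inr_zero]
  rw [Unitization.inr_sub, mul_sub, sub_eq_zero, Unitization.inr_mul, ← mul_assoc, hXq,
    ← Unitization.inr_mul, hqc, Unitization.inr_mul] at hXc
  rw [mul_assoc, hc, hXc]

/-- The case `X = [e]`, `Y = []` of tightness gives `q * π e = π e`, and minimality of `q` gives `q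
= q * π e`. -/
theorem IsTight.isProjJoin (hπ : IsSemigroupRep π) (ht : IsTight π) {e : ZM V} (he : e * e = e)
    {Z : Finset (ZM V)} (hZ : IsIdemCover Z (idemBetween [e] [])) :
    IsProjJoin (π '' (Z : Set (ZM V))) (π e) := by
  obtain ⟨q, hq, h⟩ := ht [e] [] Z (by simpa using he) (by simp) hZ
  have h1 := h e
  simp only [List.map_cons, List.map_nil, List.prod_cons, List.prod_nil, mul_one,
    ← Unitization.inr_mul, ← hπ.map_mul, he] at h1
  have h2 : q * π e = π e := Unitization.inr_injective (R := ℂ) h1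
  have h3 : q = q * π e := by
    refine hq.2.2 _ (hπ.isStarProjection he) ?_
    rintro _ ⟨z, hz, rfl⟩
    rw [← hπ.map_mul, (hZ.1 hz).2.1 e (by simp)]
  rw [← h2, ← h3]
  exact hq

open Classical in
theorem isIdemCover_image_idem {e : ZM V} (he : e * e = e) {F : Finset (Arrow V)}
    (hle : ∀ α ∈ F, α ∈ e.dom) (h : ∀ α ∈ e.dom, ∃ β ∈ F, (ideal α ∩ ideal β).Nonempty) :
    IsIdemCover (F.image idem) (idemBetween [e] []) := by
  refine ⟨?_, ?_⟩
  · intro z hz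
    obtain ⟨α, hα, rfl⟩ := Finset.mem_image.1 hz
    refine ⟨idem_mul_idem α, ?_, by simp⟩
    simp only [List.mem_singleton, forall_eq]
    rw [ZM.mul_eq_left_iff (idem_mul_idem α) he, dom_idem]
    exact fun ε hε => ZM.mem_dom_of_mem_ideal (hle α hα) hε
  · rintro f ⟨hf, hfe, -⟩ hne
    obtain ⟨α, hα⟩ := ZM.ne_zero_iff_dom.1 hne
    have h1 := (ZM.mul_eq_left_iff hf he).1 (hfe e (by simp))
    obtain ⟨β, hβ, γ, h2, h3⟩ := h α (h1 hα)
    refine ⟨idem β, Finset.mem_image_of_mem _ hβ, ?_⟩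
    rw [ZM.ne_zero_iff_dom, ZM.dom_mul_idem (idem_mul_idem β) hf, dom_idem]
    exact ⟨γ, h3, ZM.mem_dom_of_mem_ideal hα h2⟩

theorem IsSemigroupRep.image_idem (hπ : IsSemigroupRep π) (F : Finset (Arrow V)) :
    (fun γ => π (tau γ) * star (π (tau γ))) '' (F : Set (Arrow V)) =
      π '' (idem '' (F : Set (Arrow V))) := by
  rw [Set.image_image]
  simp only [hπ.map_idem]

/-- Conditions (3) and (4) are both joins over a cover of one idempotent by range idempotents: `idem
α * idem β` covered through `α ∨ β`, and `τ_v` covered through an exhaustive set. -/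
theorem IsTight.isCovariant (hπ : IsSemigroupRep π) (ht : IsTight π) :
    IsCovariant fun α => π (tau α) := by
  classical
  refine ⟨⟨fun α => ?_, fun α β h => ?_, fun α β L hL => ?_⟩, fun v F hF => ?_⟩
  · rw [← hπ.map_star, ← hπ.map_mul, star_tau_mul_tau]
  · rw [← hπ.map_mul, tau_mul_tau]
  · have hd : (idem α * idem β).dom = ideal α ∩ ideal β := by
      rw [ZM.dom_mul_idem (idem_mul_idem α) (idem_mul_idem β), dom_idem, dom_idem]
    have h := ht.isProjJoin hπ (ZM.mul_idem (idem_mul_idem α) (idem_mul_idem β))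
      (isIdemCover_image_idem (F := L) (ZM.mul_idem (idem_mul_idem α) (idem_mul_idem β))
        (fun γ hγ => ?_) fun γ hγ => ?_)
    · rw [hπ.image_idem, ← hπ.map_idem, ← hπ.map_idem, ← hπ.map_mul, ← Finset.coe_image]
      exact h
    · rw [hd, hL.2]
      exact Set.mem_biUnion hγ (self_mem_ideal γ)
    · rw [hd, hL.2] at hγ
      simp only [Set.mem_iUnion, exists_prop] at hγ
      obtain ⟨δ, hδ, h⟩ := hγ
      exact ⟨δ, hδ, γ, self_mem_ideal γ, h⟩
  · have h := ht.isProjJoin hπ (tau_id_idem v)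
      (isIdemCover_image_idem (F := F) (tau_id_idem v) (fun γ hγ => ?_) fun γ hγ => ?_)
    · rw [hπ.image_idem, ← Finset.coe_image]
      exact h
    · rw [dom_tau_id]
      exact mem_ideal_id (hF.1 γ hγ)
    · rw [dom_tau_id] at hγ
      exact hF.2 γ (right_eq_of_mem_ideal hγ)

theorem IsAssociated.eq_comp_tau (hπ : IsAssociated T π) : T = fun α => π (tau α) :=
  funext fun α => (hπ.2 α).symm

theorem IsAssociated.isCovariant_iff_isTight (hV : FinitelyAligned V) (hπ : IsAssociated T π) :
    IsCovariant T ↔ IsTight π :=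
  ⟨fun hT => hT.isTight hV hπ, fun h => hπ.eq_comp_tau ▸ h.isCovariant hπ.1⟩

end Tightness

/-! ### Covariance and the cover-to-join property -/

section CoverToJoin

variable {V : Type u} [Category.{v} V] [LeftCancellative V]
  {B : Type w} [NonUnitalCStarAlgebra B] {T : Arrow V → B} {π : ZM V → B}

theorem IsCovariant.isCoverToJoin (hV : FinitelyAligned V) (hT : IsCovariant T)
    (hπ : IsAssociated T π) : IsCoverToJoin π := by
  classical
  intro a C hC
  have hR := hT.toIsRepresentation
  refine ⟨hπ.1.isPartialIsometry a, ?_, fun r hr hCr => ?_⟩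
  · rintro _ ⟨c, hc, rfl⟩
    have h := hC.1 c hc
    unfold PartialIsometryLE
    unfold NaturalLE at h
    rw [← hπ.1.map_star, ← hπ.1.map_mul, ← hπ.1.map_mul, ← h]
  · have hle : ∀ c ∈ C, ∀ β γ, c.Maps β γ → a.Maps β γ := fun c hc =>
      ZM.naturalLE_iff.1 (hC.1 c hc)
    -- It suffices to test against `star (T γ)` for `γ` in the range of `a`. The ranges of the `c ∈
    -- C`, that is the domains of the `star c`, meet every ideal inside `γ𝒞`, because `C` covers the
    -- restrictions of `a`.
    have key : star (π a) * (π a * star (π a) * r - π a) = 0 := by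
      refine (hπ.implements hV hR a).actsAs_star.annihilates _ ?_
      rintro γ ⟨β, hβ⟩
      rw [ZM.maps_star] at hβ
      refine hT.star_mul_eq_zero hV (C.image star) ?_ ?_
      · rintro _ ⟨α, hα, rfl⟩
        obtain ⟨h1, h2⟩ := a.maps_comp hβ
        have hm := h2 α (h1.trans hα) hα
        have hs : NaturalLE (a * idem (comp β α (h1.trans hα))) a := by
          refine ZM.naturalLE_iff.2 fun δ ε h => ?_
          obtain ⟨η, h3, h4⟩ := ZM.maps_mul.1 h
          have := h3.eq_of_idem (idem_mul_idem _)
          subst this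
          exact h4
        have hs0 : a * idem (comp β α (h1.trans hα)) ≠ 0 := ZM.ne_zero_iff.2
          ⟨_, _, ZM.maps_mul.2 ⟨_, ZM.maps_self_of_mem_dom (idem_mul_idem _)
            (by rw [dom_idem]; exact self_mem_ideal _), hm⟩⟩
        obtain ⟨c, hc, b, hb0, hbs, hbc⟩ := hC.2 _ hs0 hs
        obtain ⟨δ, ε, hb⟩ := ZM.ne_zero_iff.1 hb0
        have hbs := ZM.naturalLE_iff.1 hbs _ _ hb
        obtain ⟨η, h3, h4⟩ := ZM.maps_mul.1 hbs
        have := h3.eq_of_idem (idem_mul_idem _)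
        subst this
        have hδ : δ ∈ ideal (comp β α (h1.trans hα)) := by
          rw [← dom_idem]
          exact ⟨_, h3⟩
        obtain ⟨κ, hκ, rfl⟩ := hδ
        refine ⟨star c, Finset.mem_image_of_mem _ hc, ε, ?_, _,
          ZM.maps_star.2 (ZM.naturalLE_iff.1 hbc _ _ hb)⟩
        have h5 := (a.maps_comp hm).2 κ hκ hκ
        rw [h4.functional h5]
        exact comp_mem_ideal _ _ _
      · rintro ε hε ⟨f, hf, hεf⟩
        obtain ⟨c, hc, rfl⟩ := Finset.mem_image.1 hf
        obtain ⟨δ, hδ⟩ := hεf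
        rw [ZM.maps_star] at hδ
        have ha := hπ.implements hV hR a
        have hci := hπ.implements hV hR c
        have hδa := hle c hc _ _ hδ
        -- An upper bound `r` of `π(C)` agrees with `π c`, and so with `π a`, under `star (T ε)` for
        -- `ε` in the range of `c`.
        have hr1 : star (T ε) * r = star (T δ) := by
          have h1 : π c = π c * star (π c) * r := hCr _ ⟨c, hc, rfl⟩
          rw [← hci.star_apply_mul hδ, h1, ← mul_assoc, ← mul_assoc, hci.star_apply_mul hδ,
            hci.star.star_apply_mul (ZM.maps_star.2 hδ)]
        rw [mul_sub, ← mul_assoc, ← mul_assoc, ha.star_apply_mul hδa,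
          ha.star.star_apply_mul (ZM.maps_star.2 hδa), hr1, sub_self]
    have hpa : π a * star (π a) * π a = π a := hπ.1.isPartialIsometry a
    unfold PartialIsometryLE
    have h1 : π a * (star (π a) * (π a * star (π a) * r - π a)) = 0 := by rw [key, mul_zero]
    rw [← mul_assoc, mul_sub, ← mul_assoc, ← mul_assoc, hpa, sub_eq_zero] at h1
    exact h1.symm

theorem IsCoverToJoin.isCovariant (hT : IsRepresentation T) (hπ : IsAssociated T π)
    (h : IsCoverToJoin π) : IsCovariant T := by
  classical
  refine ⟨hT, fun v F hF => ?_⟩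
  have hcov : IsCover (F.image idem) (tau (Arrow.mk (𝟙 v))) := by
    have hsub : ∀ α ∈ F, (idem α).dom ⊆ (tau (Arrow.mk (𝟙 v) : Arrow V)).dom := by
      intro α hα
      rw [dom_idem, dom_tau_id]
      exact ideal_subset_ideal (mem_ideal_id (hF.1 α hα))
    refine ⟨?_, fun s hs0 hs => ?_⟩
    · intro c hc
      obtain ⟨α, hα, rfl⟩ := Finset.mem_image.1 hc
      refine ZM.naturalLE_iff.2 fun β γ hm => ?_
      have := hm.eq_of_idem (idem_mul_idem α)
      subst this
      exact ZM.maps_self_of_mem_dom (tau_id_idem v) (hsub α hα ⟨_, hm⟩)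
    · obtain ⟨β, γ, hm⟩ := ZM.ne_zero_iff.1 hs0
      have hs := ZM.naturalLE_iff.1 hs
      have hid : ∀ {β γ}, s.Maps β γ → β = γ := fun hm => (hs _ _ hm).eq_of_idem (tau_id_idem v)
      have := hid hm
      subst this
      have hβ : β ∈ (tau (Arrow.mk (𝟙 v) : Arrow V)).dom := ⟨_, hs _ _ hm⟩
      rw [dom_tau_id] at hβ
      obtain ⟨α, hα, δ, h1, h2⟩ := hF.2 β (right_eq_of_mem_ideal hβ)
      -- Here `s` is a partial identity, so its restriction to `α𝒞` lies below both `s` and `idem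
      -- α`. It is nonzero at the common extension `δ` of `β` and `α`.
      refine ⟨idem α, Finset.mem_image_of_mem _ hα, s * idem α, ?_, ?_, ?_⟩
      · obtain ⟨ε, hε⟩ := ZM.mem_dom_of_mem_ideal ⟨_, hm⟩ h1
        refine ZM.ne_zero_iff.2 ⟨δ, ε, ZM.maps_mul.2 ⟨δ, ?_, hε⟩⟩
        exact ZM.maps_self_of_mem_dom (idem_mul_idem α) (by rwa [dom_idem])
      · refine ZM.naturalLE_iff.2 fun η ε h => ?_
        obtain ⟨κ, h3, h4⟩ := ZM.maps_mul.1 h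
        have := h3.eq_of_idem (idem_mul_idem _)
        subst this
        exact h4
      · refine ZM.naturalLE_iff.2 fun η ε h => ?_
        obtain ⟨κ, h3, h4⟩ := ZM.maps_mul.1 h
        have := hid h4
        subst this
        exact h3
  have hj := h _ _ hcov
  have himg : π '' ((F.image idem : Finset (ZM V)) : Set (ZM V)) =
      (fun α => T α * star (T α)) '' (F : Set (Arrow V)) := by
    rw [Finset.coe_image, Set.image_image]
    simp only [hπ.map_idem]
  rw [himg, hπ.2] at hj
  have hv : IsStarProjection (T (Arrow.mk (𝟙 v))) := by
    rw [← hπ.2]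
    exact hπ.1.isStarProjection (tau_id_idem v)
  -- For a projection `p` the order of partial isometries reduces to that of projections. A join
  -- among partial isometries that is a projection is therefore also the join among projections.
  have hle : ∀ {p r : B}, IsStarProjection p → (PartialIsometryLE p r ↔ p = p * r) := by
    intro p r hp
    have : p * p = p := hp.isIdempotentElem
    rw [PartialIsometryLE, hp.isSelfAdjoint.star_eq, this]
  refine ⟨hv, ?_, fun r hr hFr => ?_⟩
  · rintro _ ⟨α, hα, rfl⟩
    exact (hle (hT.isStarProjection α)).1 (hj.2.1 _ ⟨α, hα, rfl⟩)
  · refine (hle hv).1 (hj.2.2 r ?_ ?_)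
    · have : r * r = r := hr.isIdempotentElem
      rw [IsPartialIsometry, hr.isSelfAdjoint.star_eq, this, this]
    · rintro _ ⟨α, hα, rfl⟩
      exact (hle (hT.isStarProjection α)).2 (hFr _ ⟨α, hα, rfl⟩)

theorem IsAssociated.isCovariant_iff_isCoverToJoin (hV : FinitelyAligned V)
    (hT : IsRepresentation T) (hπ : IsAssociated T π) : IsCovariant T ↔ IsCoverToJoin π :=
  ⟨fun h => h.isCoverToJoin hV hπ, fun h => h.isCovariant hT hπ⟩

end CoverToJoin

/-! ### Comparison of the two universal properties -/

section UniversalProperties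

variable {V : Type u} [Category.{v} V] [LeftCancellative V]

theorem IsAssociated.isCuntzKriegerAlgebra_iff (hV : FinitelyAligned V) {A : Type x}
    [NonUnitalCStarAlgebra A] {t : Arrow V → A} {π : ZM V → A} (hπ : IsAssociated t π) :
    IsCuntzKriegerAlgebra.{w} t ↔ IsTightCStarAlgebra.{w} π := by
  -- Composing `π` with `φ` gives a representation of `ZM V`, which is determined by its values on
  -- the `τ_α`.
  have hcomp : ∀ {B : Type w} [NonUnitalCStarAlgebra B] {T : Arrow V → B} {ρ : ZM V → B},
      IsAssociated T ρ → ∀ φ : A →⋆ₙₐ[ℂ] B, (∀ α, φ (t α) = T α) ↔ ∀ s, φ (π s) = ρ s := by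
    intro B _ T ρ hρ φ
    constructor
    · intro h s
      have h1 : IsAssociated T fun s => φ (π s) :=
        ⟨⟨fun s t => by rw [hπ.1.map_mul, map_mul], fun s => by rw [hπ.1.map_star, map_star],
          by rw [hπ.1.map_zero, map_zero]⟩, fun α => by rw [← h, ← hπ.2]⟩
      exact congrFun (h1.unique hρ) s
    · intro h α
      rw [← hπ.2, h, hρ.2]
  constructor
  · rintro ⟨ht, h⟩
    refine ⟨hπ.1, ht.isTight hV hπ, fun B _ ρ hρ hρt => ?_⟩
    have := h B (fun α => ρ (tau α)) (hρt.isCovariant hρ)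
    simpa only [hcomp (T := fun α => ρ (tau α)) ⟨hρ, fun _ => rfl⟩] using this
  · rintro ⟨_, ht, h⟩
    refine ⟨(hπ.isCovariant_iff_isTight hV).2 ht, fun B _ T hT => ?_⟩
    obtain ⟨ρ, hρ⟩ := hT.toIsRepresentation.exists_isAssociated hV
    have := h B ρ hρ.1 (hT.isTight hV hρ)
    simpa only [hcomp hρ] using this

end UniversalProperties

/-! ### The completion of a pre-C*-algebra -/

section Completion

open UniformSpace UniformSpace.Completion IsDenseInducing

variable {R : Type*} [NonUnitalSeminormedRing R]

noncomputable instance completionMul : Mul (Completion R) :=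
  ⟨Function.curry <| (isDenseInducing_coe.prodMap isDenseInducing_coe).extend
    ((↑) ∘ Function.uncurry ((· * ·) : R → R → R))⟩

theorem completion_coe_mul (a b : R) : ((a * b : R) : Completion R) = a * b :=
  ((isDenseInducing_coe.prodMap isDenseInducing_coe).extend_eq
      ((continuous_coe R).comp (@continuous_mul R _ _ _)) (a, b)).symm

instance completionContinuousMul : ContinuousMul (Completion R) where
  continuous_mul := by
    let m := (AddMonoidHom.mul : R →+ R →+ R).compr₂ toCompl
    have : Continuous fun p : R × R => m p.1 p.2 := (continuous_coe R).comp continuous_mul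
    have di : IsDenseInducing (toCompl : R → Completion R) := isDenseInducing_coe
    exact (di.extend_Z_bilin di this :)

noncomputable instance completionNonUnitalNormedRing : NonUnitalNormedRing (Completion R) where
  __ : NormedAddCommGroup (Completion R) := inferInstance
  __ : Mul (Completion R) := inferInstance
  zero_mul a := Completion.induction_on a (isClosed_eq (by fun_prop) continuous_const)
    fun a => by rw [← coe_zero, ← completion_coe_mul, zero_mul]
  mul_zero a := Completion.induction_on a (isClosed_eq (by fun_prop) continuous_const)
    fun a => by rw [← coe_zero, ← completion_coe_mul, mul_zero]
  mul_assoc a b c := Completion.induction_on₃ a b c (isClosed_eq (by fun_prop) (by fun_prop))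
    fun a b c => by simp only [← completion_coe_mul, mul_assoc]
  left_distrib a b c := Completion.induction_on₃ a b c (isClosed_eq (by fun_prop) (by fun_prop))
    fun a b c => by simp only [← completion_coe_mul, ← coe_add, mul_add]
  right_distrib a b c := Completion.induction_on₃ a b c (isClosed_eq (by fun_prop) (by fun_prop))
    fun a b c => by simp only [← completion_coe_mul, ← coe_add, add_mul]
  norm_mul_le x y := Completion.induction_on₂ x y (isClosed_le (by fun_prop) (by fun_prop))
    fun a b => by simpa only [← completion_coe_mul, norm_coe] using norm_mul_le a b

variable [StarRing R]

noncomputable instance completionStar : Star (Completion R) := ⟨Completion.map star⟩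

theorem completion_continuous_star : Continuous (star : Completion R → Completion R) :=
  continuous_map

variable [NormedStarGroup R]

theorem completion_coe_star (a : R) : ((star a : R) : Completion R) = star (a : Completion R) :=
  (map_coe (starNormedAddGroupHom (E := R)).uniformContinuous a).symm

noncomputable instance completionStarRing : StarRing (Completion R) where
  star_involutive a := Completion.induction_on a
    (isClosed_eq (completion_continuous_star.comp completion_continuous_star) continuous_id)
    fun a => by rw [← completion_coe_star, ← completion_coe_star, star_star]
  star_mul a b := Completion.induction_on₂ a b
    (isClosed_eq (completion_continuous_star.comp continuous_mul)
      ((completion_continuous_star.comp continuous_snd).mul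
        (completion_continuous_star.comp continuous_fst)))
    fun a b => by simp only [← completion_coe_mul, ← completion_coe_star, star_mul]
  star_add a b := Completion.induction_on₂ a b
    (isClosed_eq (completion_continuous_star.comp continuous_add)
      ((completion_continuous_star.comp continuous_fst).add
        (completion_continuous_star.comp continuous_snd)))
    fun a b => by simp only [← coe_add, ← completion_coe_star, star_add]

theorem completion_cstarRing (h : ∀ a : R, ‖a‖ * ‖a‖ ≤ ‖star a * a‖) :
    CStarRing (Completion R) where
  norm_mul_self_le x := by
    induction x using Completion.induction_on with
    | hp =>
      exact isClosed_le (continuous_norm.mul continuous_norm)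
        ((completion_continuous_star.mul continuous_id).norm)
    | ih a =>
      rw [← completion_coe_star, ← completion_coe_mul, norm_coe, norm_coe]
      exact h a

section Scalars

variable [NormedSpace ℂ R]

instance completionIsScalarTower [IsScalarTower ℂ R R] :
    IsScalarTower ℂ (Completion R) (Completion R) where
  smul_assoc c x y := by
    change (c • x) * y = c • (x * y)
    induction x, y using Completion.induction_on₂ with
    | hp =>
      exact isClosed_eq ((continuous_fst.const_smul c).mul continuous_snd)
        (continuous_mul.const_smul c)
    | ih a b => rw [← coe_smul, ← completion_coe_mul, ← completion_coe_mul, ← coe_smul,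
        smul_mul_assoc]

instance completionSMulCommClass [SMulCommClass ℂ R R] :
    SMulCommClass ℂ (Completion R) (Completion R) where
  smul_comm c x y := by
    change c • (x * y) = x * (c • y)
    induction x, y using Completion.induction_on₂ with
    | hp =>
      exact isClosed_eq (continuous_mul.const_smul c)
        (continuous_fst.mul (continuous_snd.const_smul c))
    | ih a b => rw [← coe_smul, ← completion_coe_mul, ← completion_coe_mul, ← coe_smul,
        mul_smul_comm]

instance completionStarModule [StarModule ℂ R] : StarModule ℂ (Completion R) where
  star_smul c x := by
    induction x using Completion.induction_on with
    | hp =>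
      exact isClosed_eq (completion_continuous_star.comp (continuous_const_smul c))
        ((continuous_const_smul (star c)).comp completion_continuous_star)
    | ih a => rw [← coe_smul, ← completion_coe_star, ← completion_coe_star, ← coe_smul, star_smul]

/-- The completion of a pre-C*-algebra is a C*-algebra. -/
noncomputable abbrev completionCStarAlgebra [IsScalarTower ℂ R R]
    [SMulCommClass ℂ R R] [StarModule ℂ R] (h : ∀ a : R, ‖a‖ * ‖a‖ ≤ ‖star a * a‖) :
    NonUnitalCStarAlgebra (Completion R) :=
  { completionNonUnitalNormedRing, completionStarRing,
    (inferInstance : NormedSpace ℂ (Completion R)), completionIsScalarTower,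
    completionSMulCommClass, completionStarModule, completion_cstarRing h,
    (inferInstance : CompleteSpace (Completion R)) with }

end Scalars

end Completion

/-! ### C*-seminorms and enveloping C*-algebras -/

section CStarSeminorms

variable {R : Type u} [NonUnitalRing R] [StarRing R] [Module ℂ R]

/-- C*-seminorms on a *-algebra. -/
structure IsCStarSeminorm (p : R → ℝ) : Prop where
  nonneg : ∀ a, 0 ≤ p a
  add_le : ∀ a b, p (a + b) ≤ p a + p b
  smul_le : ∀ (c : ℂ) a, p (c • a) ≤ ‖c‖ * p a
  mul_le : ∀ a b, p (a * b) ≤ p a * p b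
  star_le : ∀ a, p (star a) ≤ p a
  mul_self_le : ∀ a, p a * p a ≤ p (star a * a)

theorem IsCStarSeminorm.zero {p : R → ℝ} (hp : IsCStarSeminorm p) : p 0 = 0 := by
  refine le_antisymm ?_ (hp.nonneg 0)
  simpa using hp.smul_le 0 0

theorem IsCStarSeminorm.neg {p : R → ℝ} (hp : IsCStarSeminorm p) (a : R) : p (-a) = p a := by
  have h : ∀ a, p (-a) ≤ p a := fun a => by simpa using hp.smul_le (-1) a
  refine le_antisymm (h a) ?_
  simpa using h (-a)

theorem isCStarSeminorm_norm {B : Type*} [NonUnitalCStarAlgebra B] (φ : R →⋆ₙₐ[ℂ] B) :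
    IsCStarSeminorm fun a => ‖φ a‖ where
  nonneg a := norm_nonneg _
  add_le a b := by simpa using norm_add_le (φ a) (φ b)
  smul_le c a := by simp [norm_smul]
  mul_le a b := by simpa using norm_mul_le (φ a) (φ b)
  star_le a := by simp [map_star]
  mul_self_le a := by simp [map_star, CStarRing.norm_star_mul_self]

/-- The pointwise supremum of a pointwise bounded set of C*-seminorms is a C*-seminorm. -/
theorem isCStarSeminorm_sSup {N : Set (R → ℝ)} (hN : ∀ p ∈ N, IsCStarSeminorm p)
    (hb : ∀ a, ∃ C, ∀ p ∈ N, p a ≤ C) :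
    IsCStarSeminorm (fun a => sSup ((fun p => p a) '' N)) ∧
      ∀ p ∈ N, ∀ a, p a ≤ sSup ((fun p => p a) '' N) := by
  have hle : ∀ p ∈ N, ∀ a, p a ≤ sSup ((fun p => p a) '' N) := by
    intro p hp a
    obtain ⟨C, hC⟩ := hb a
    refine le_csSup ⟨C, ?_⟩ ⟨p, hp, rfl⟩
    rintro _ ⟨q, hq, rfl⟩
    exact hC q hq
  have hnn : ∀ a, 0 ≤ sSup ((fun p => p a) '' N) := by
    intro a
    refine Real.sSup_nonneg ?_
    rintro _ ⟨p, hp, rfl⟩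
    exact (hN p hp).nonneg a
  -- The bound `0 ≤ C` covers empty `N`, where the real supremum is `0`.
  have hsup : ∀ a {C : ℝ}, 0 ≤ C → (∀ p ∈ N, p a ≤ C) → sSup ((fun p => p a) '' N) ≤ C := by
    intro a C hC h
    refine Real.sSup_le ?_ hC
    rintro _ ⟨p, hp, rfl⟩
    exact h p hp
  refine ⟨⟨hnn, fun a b => ?_, fun c a => ?_, fun a b => ?_, fun a => ?_, fun a => ?_⟩, hle⟩
  · exact hsup _ (add_nonneg (hnn _) (hnn _)) fun p hp =>
      ((hN p hp).add_le a b).trans (add_le_add (hle p hp a) (hle p hp b))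
  · exact hsup _ (mul_nonneg (norm_nonneg _) (hnn _)) fun p hp =>
      ((hN p hp).smul_le c a).trans (mul_le_mul_of_nonneg_left (hle p hp a) (norm_nonneg _))
  · exact hsup _ (mul_nonneg (hnn _) (hnn _)) fun p hp =>
      ((hN p hp).mul_le a b).trans
        (mul_le_mul (hle p hp a) (hle p hp b) ((hN p hp).nonneg b) (hnn a))
  · exact hsup _ (hnn _) fun p hp => ((hN p hp).star_le a).trans (hle p hp a)
  · have h : sSup ((fun p => p a) '' N) ≤ √(sSup ((fun p => p (star a * a)) '' N)) :=
      hsup _ (Real.sqrt_nonneg _) fun p hp => Real.le_sqrt_of_sq_le <| by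
        rw [sq]
        exact ((hN p hp).mul_self_le a).trans (hle p hp _)
    calc _ ≤ √(sSup ((fun p => p (star a * a)) '' N)) * √(sSup ((fun p => p (star a * a)) '' N)) :=
          mul_self_le_mul_self (hnn a) h
      _ = _ := Real.mul_self_sqrt (hnn _)

/-- The Hausdorff completion of a *-algebra with respect to a C*-seminorm. -/
theorem IsCStarSeminorm.exists_completion [IsScalarTower ℂ R R] [SMulCommClass ℂ R R]
    [StarModule ℂ R] {p : R → ℝ} (hp : IsCStarSeminorm p) :
    ∃ (A : Type u) (_ : NonUnitalCStarAlgebra A) (ι : R →⋆ₙₐ[ℂ] A),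
      (∀ a, ‖ι a‖ = p a) ∧ DenseRange ι := by
  -- The seminorm only makes `R` a seminormed ring. Its null space disappears because the completion
  -- is Hausdorff.
  let q : AddGroupSeminorm R := ⟨p, hp.zero, hp.add_le, hp.neg⟩
  let : NonUnitalSeminormedRing R :=
    { (inferInstance : NonUnitalRing R), q.toSeminormedAddCommGroup with
      norm_mul_le := hp.mul_le }
  let : NormedSpace ℂ R := ⟨hp.smul_le⟩
  have : NormedStarGroup R := ⟨hp.star_le⟩
  let := completionCStarAlgebra (R := R) hp.mul_self_le
  refine ⟨UniformSpace.Completion R, inferInstance,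
    { toFun := fun a => a
      map_smul' := fun c a => UniformSpace.Completion.coe_smul c a
      map_zero' := UniformSpace.Completion.coe_zero
      map_add' := UniformSpace.Completion.coe_add
      map_mul' := completion_coe_mul
      map_star' := completion_coe_star }, fun a => ?_, ?_⟩
  · exact UniformSpace.Completion.norm_coe a
  · exact UniformSpace.Completion.denseRange_coe

/-- Domination of norms lets `φ` factor through the dense range of `ι` and extend by continuity.
Multiplicativity and the star are closed conditions, checked on that range. -/
theorem exists_extension {A B : Type*} [NonUnitalCStarAlgebra A] [NonUnitalCStarAlgebra B]
    (ι : R →⋆ₙₐ[ℂ] A) (hι : DenseRange ι) (φ : R →⋆ₙₐ[ℂ] B) (h : ∀ a, ‖φ a‖ ≤ ‖ι a‖) :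
    ∃ ψ : A →⋆ₙₐ[ℂ] B, ∀ a, ψ (ι a) = φ a := by
  let i : R →ₗ[ℂ] A := (ι : R →ₗ[ℂ] A)
  let f : R →ₗ[ℂ] B := (φ : R →ₗ[ℂ] B)
  have hψ : ∀ a, f.extendOfNorm i (ι a) = φ a :=
    LinearMap.extendOfNorm_eq (f := f) (e := i) hι ⟨1, fun a => by rw [one_mul]; exact h a⟩
  generalize f.extendOfNorm i = ψ at hψ
  refine ⟨{ ψ with
    map_zero' := map_zero ψ
    map_mul' := fun x y => ?_
    map_star' := fun x => ?_ }, hψ⟩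
  · change ψ (x * y) = ψ x * ψ y
    refine hι.induction_on₂ (p := fun x y => ψ (x * y) = ψ x * ψ y)
      (isClosed_eq (by fun_prop) (by fun_prop)) (fun a b => ?_) x y
    rw [← map_mul, hψ, hψ, hψ, map_mul]
  · change ψ (star x) = star (ψ x)
    refine hι.induction_on (p := fun x => ψ (star x) = star (ψ x)) x
      (isClosed_eq (by fun_prop) (by fun_prop)) fun a => ?_
    rw [← map_star, hψ, hψ, map_star]

theorem NonUnitalStarAlgHom.ext_of_denseRange {A B : Type*} [NonUnitalCStarAlgebra A]
    [NonUnitalCStarAlgebra B] {ι : R →⋆ₙₐ[ℂ] A} (hι : DenseRange ι) {ψ ψ' : A →⋆ₙₐ[ℂ] B}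
    (h : ∀ a, ψ (ι a) = ψ' (ι a)) : ψ = ψ' := by
  have hc : ∀ ψ : A →⋆ₙₐ[ℂ] B, Continuous ψ := fun ψ =>
    AddMonoidHomClass.continuous_of_bound ψ 1 fun a => by
      simpa using NonUnitalStarAlgHom.norm_apply_le ψ a
  exact DFunLike.coe_injective (hι.equalizer (hc ψ) (hc ψ') (funext h))

end CStarSeminorms

/-! ### The *-algebra of a semigroup with involution -/

section StarMonoidAlgebra

variable {S : Type*} [Semigroup S] [StarMul S]

open MonoidAlgebra

noncomputable instance monoidAlgebraStar : Star (MonoidAlgebra ℂ S) where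
  star a := ∑ s ∈ a.coeff.support, single (star s) (star (a.coeff s))

theorem star_eq_sum (a : MonoidAlgebra ℂ S) :
    star a = a.coeff.sum fun s c => single (star s) (star c) := rfl

theorem star_single (s : S) (c : ℂ) :
    star (single s c : MonoidAlgebra ℂ S) = single (star s) (star c) := by
  simp [star_eq_sum]

theorem monoidAlgebra_star_add (a b : MonoidAlgebra ℂ S) : star (a + b) = star a + star b := by
  classical
  simp only [star_eq_sum, coeff_add]
  exact Finsupp.sum_add_index' (by simp) (by simp)

theorem monoidAlgebra_star_zero : star (0 : MonoidAlgebra ℂ S) = 0 := by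
  simp [star_eq_sum]

noncomputable instance monoidAlgebraStarRing : StarRing (MonoidAlgebra ℂ S) where
  star_involutive a := by
    induction a using MonoidAlgebra.induction_linear with
    | zero => simp only [monoidAlgebra_star_zero]
    | add a b ha hb => simp only [monoidAlgebra_star_add, ha, hb]
    | single s c => simp only [star_single, star_star]
  star_add := monoidAlgebra_star_add
  star_mul a b := by
    induction a using MonoidAlgebra.induction_linear with
    | zero => simp only [monoidAlgebra_star_zero, zero_mul, mul_zero]
    | add a a' ha ha' => simp only [monoidAlgebra_star_add, ha, ha', add_mul, mul_add]
    | single s c =>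
      induction b using MonoidAlgebra.induction_linear with
      | zero => simp only [monoidAlgebra_star_zero, zero_mul, mul_zero]
      | add a a' ha ha' => simp only [monoidAlgebra_star_add, ha, ha', add_mul, mul_add]
      | single t d => simp only [star_single, single_mul_single, star_mul]

instance monoidAlgebraStarModule : StarModule ℂ (MonoidAlgebra ℂ S) where
  star_smul c a := by
    induction a using MonoidAlgebra.induction_linear with
    | zero => simp only [monoidAlgebra_star_zero, smul_zero]
    | add a b ha hb => simp only [monoidAlgebra_star_add, ha, hb, smul_add]
    | single s d => simp only [star_single, smul_single, smul_eq_mul, star_mul']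

/-- The linear extension of a *-preserving multiplicative map. -/
noncomputable def liftStar {B : Type*} [NonUnitalCStarAlgebra B] (ρ : S → B)
    (hmul : ∀ s t, ρ (s * t) = ρ s * ρ t) (hstar : ∀ s, ρ (star s) = star (ρ s)) :
    MonoidAlgebra ℂ S →⋆ₙₐ[ℂ] B :=
  { liftMagma ℂ ⟨ρ, hmul⟩ with
    map_star' := fun a => by
      change liftMagma ℂ ⟨ρ, hmul⟩ (star a) = star (liftMagma ℂ ⟨ρ, hmul⟩ a)
      induction a using MonoidAlgebra.induction_linear with
      | zero => simp only [map_zero, star_zero]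
      | add a b ha hb => simp only [map_add, star_add, ha, hb]
      | single s c => simp [star_single, hstar] }

theorem liftStar_single {B : Type*} [NonUnitalCStarAlgebra B] (ρ : S → B)
    (hmul : ∀ s t, ρ (s * t) = ρ s * ρ t) (hstar : ∀ s, ρ (star s) = star (ρ s)) (s : S) (c : ℂ) :
    liftStar ρ hmul hstar (single s c) = c • ρ s := by
  change liftMagma ℂ ⟨ρ, hmul⟩ (single s c) = _
  simp

end StarMonoidAlgebra

/-! ### Existence of the Cuntz–Krieger algebra -/

section UniversalAlgebra

variable {V : Type u} [Category.{v} V] [LeftCancellative V]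

open MonoidAlgebra

/-- The *-homomorphism on the *-algebra of `ZM(𝒞)` induced by a representation. -/
noncomputable def IsSemigroupRep.lift {B : Type*} [NonUnitalCStarAlgebra B] {ρ : ZM V → B}
    (hρ : IsSemigroupRep ρ) : MonoidAlgebra ℂ (ZM V) →⋆ₙₐ[ℂ] B :=
  liftStar ρ hρ.map_mul hρ.map_star

theorem IsSemigroupRep.lift_single {B : Type*} [NonUnitalCStarAlgebra B] {ρ : ZM V → B}
    (hρ : IsSemigroupRep ρ) (s : ZM V) (c : ℂ) : hρ.lift (single s c) = c • ρ s :=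
  liftStar_single _ _ _ _ _

theorem IsSemigroupRep.norm_le_one {B : Type*} [NonUnitalCStarAlgebra B] {ρ : ZM V → B}
    (hρ : IsSemigroupRep ρ) (s : ZM V) : ‖ρ s‖ ≤ 1 := by
  have h := (hρ.isStarProjection (ZM.mul_star_idem s)).norm_le
  rw [hρ.map_mul, hρ.map_star, CStarRing.norm_self_mul_star] at h
  nlinarith [norm_nonneg (ρ s)]

/-- The C*-seminorms on the *-algebra of `ZM(𝒞)` that come from covariant representations of `𝒞`
in C*-algebras in a given universe. -/
def covariantSeminorms.{w', u', v'} (V : Type u') [Category.{v'} V] [LeftCancellative V] :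
    Set (MonoidAlgebra ℂ (ZM V) → ℝ) :=
  {p | ∃ (B : Type w') (_ : NonUnitalCStarAlgebra B) (ρ : ZM V → B) (hρ : IsSemigroupRep ρ),
    IsCovariant (fun α => ρ (tau α)) ∧ p = fun a => ‖hρ.lift a‖}

/-- Every representation sends elements of `ZM V` to contractions, which bounds finite linear
combinations uniformly over all representations. -/
theorem covariantSeminorms_bounded (a : MonoidAlgebra ℂ (ZM V)) :
    ∃ C, ∀ p ∈ covariantSeminorms.{w} V, p a ≤ C := by
  induction a using MonoidAlgebra.induction_linear with
  | zero =>
    refine ⟨0, ?_⟩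
    rintro _ ⟨B, _, ρ, hρ, _, rfl⟩
    simp
  | add a b ha hb =>
    obtain ⟨C, hC⟩ := ha
    obtain ⟨D, hD⟩ := hb
    refine ⟨C + D, ?_⟩
    rintro _ ⟨B, _, ρ, hρ, hc, rfl⟩
    change ‖hρ.lift (a + b)‖ ≤ C + D
    rw [map_add]
    exact (norm_add_le _ _).trans
      (add_le_add (hC _ ⟨B, _, ρ, hρ, hc, rfl⟩) (hD _ ⟨B, _, ρ, hρ, hc, rfl⟩))
  | single s c =>
    refine ⟨‖c‖, ?_⟩
    rintro _ ⟨B, _, ρ, hρ, _, rfl⟩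
    change ‖hρ.lift (single s c)‖ ≤ ‖c‖
    rw [hρ.lift_single, norm_smul]
    exact mul_le_of_le_one_right (norm_nonneg _) (hρ.norm_le_one s)

/-- Covariant representations form a proper class, but their seminorms form a set of functions on
the *-algebra. Hence the completion lives in `Type (max u v)` whatever the universe `w` of the
targets. -/
theorem exists_isCuntzKriegerAlgebra (hV : FinitelyAligned V) :
    ∃ (A : Type (max u v)) (_ : NonUnitalCStarAlgebra A) (t : Arrow V → A),
      IsCuntzKriegerAlgebra.{w} t := by
  classical
  have hN : ∀ p ∈ covariantSeminorms.{w} V, IsCStarSeminorm p := by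
    rintro _ ⟨B, _, ρ, hρ, _, rfl⟩
    exact isCStarSeminorm_norm _
  obtain ⟨hp, hle⟩ := isCStarSeminorm_sSup hN covariantSeminorms_bounded
  obtain ⟨A, _, ι, hι, hd⟩ := hp.exists_completion
  -- Every *-algebraic relation valid in all covariant representations holds in `A`.
  have hzero : ∀ a : MonoidAlgebra ℂ (ZM V), (∀ (B : Type w) [NonUnitalCStarAlgebra B]
      (ρ : ZM V → B) (hρ : IsSemigroupRep ρ), IsCovariant (fun α => ρ (tau α)) →
        hρ.lift a = 0) → ι a = 0 := by
    intro a h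
    refine norm_le_zero_iff.1 ?_
    rw [hι]
    refine Real.sSup_nonpos ?_
    rintro _ ⟨_, ⟨B, _, ρ, hρ, hc, rfl⟩, rfl⟩
    change ‖hρ.lift a‖ ≤ 0
    rw [h B ρ hρ hc, norm_zero]
  have hπ : IsSemigroupRep fun s : ZM V => ι (single s 1) := by
    refine ⟨fun s t => ?_, fun s => ?_, ?_⟩
    · rw [← map_mul, single_mul_single, one_mul]
    · rw [← map_star, star_single, star_one]
    -- The zero of `ZM V` is a nonzero basis vector of the semigroup algebra, and becomes `0` only
    -- in `A`.
    · refine hzero _ fun B _ ρ hρ _ => ?_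
      rw [hρ.lift_single, hρ.map_zero, smul_zero]
  have hjoin : ∀ (e : ZM V) (F : Finset (Arrow V)), (∀ (B : Type w) [NonUnitalCStarAlgebra B]
      (ρ : ZM V → B), IsSemigroupRep ρ → IsCovariant (fun α => ρ (tau α)) →
        IsProjJoin ((fun γ => ρ (idem γ)) '' (F : Set (Arrow V))) (ρ e)) →
      IsProjJoin ((fun γ => ι (single (idem γ) 1)) '' (F : Set (Arrow V))) (ι (single e 1)) := by
    intro e F h
    have hj := isProjJoin_image F (fun γ => ι (single (idem γ) 1))
      (fun i _ j _ => hπ.commute (idem_mul_idem i) (idem_mul_idem j))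
      (fun i _ => hπ.isStarProjection (idem_mul_idem i))
    -- Written as a polynomial, a join relation is the vanishing of one element, so it is inherited
    -- from the covariant representations.
    have heq : ι (joinList (F.toList.map fun γ => single (idem γ) 1) - single e 1) = 0 := by
      refine hzero _ fun B _ ρ hρ hc => ?_
      have hj' := isProjJoin_image F (fun γ => ρ (idem γ))
        (fun i _ j _ => hρ.commute (idem_mul_idem i) (idem_mul_idem j))
        (fun i _ => hρ.isStarProjection (idem_mul_idem i))
      rw [map_sub, map_joinList, hρ.lift_single, one_smul, (h B ρ hρ hc).unique hj', List.map_map]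
      simp only [Function.comp_def, hρ.lift_single, one_smul, sub_self]
    rw [map_sub, map_joinList, List.map_map, sub_eq_zero] at heq
    rw [← heq]
    exact hj
  have hcov : IsCovariant fun α : Arrow V => ι (single (tau α) 1) := by
    refine ⟨⟨fun α => ?_, fun α β h => ?_, fun α β L hL => ?_⟩, fun v F hF => ?_⟩
    · rw [← hπ.map_star, ← hπ.map_mul, star_tau_mul_tau]
    · rw [← hπ.map_mul, tau_mul_tau]
    · rw [← hπ.map_idem, ← hπ.map_idem, ← hπ.map_mul]
      simp only [← hπ.map_idem]
      refine hjoin _ L fun B _ ρ hρ hc => ?_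
      simpa only [← hρ.map_idem, ← hρ.map_mul] using hc.range_mul_range α β L hL
    · simp only [← hπ.map_idem]
      refine hjoin _ F fun B _ ρ hρ hc => ?_
      simpa only [← hρ.map_idem] using hc.exhaustive v F hF
  refine ⟨A, inferInstance, fun α => ι (single (tau α) 1), hcov, fun B _ T hT => ?_⟩
  obtain ⟨ρ, hρ⟩ := hT.toIsRepresentation.exists_isAssociated hV
  have hρc : IsCovariant fun α => ρ (tau α) := hρ.eq_comp_tau ▸ hT
  obtain ⟨ψ, hψ⟩ := exists_extension ι hd hρ.1.lift fun a => by
    rw [hι]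
    exact hle _ ⟨B, _, ρ, hρ.1, hρc, rfl⟩ a
  refine ⟨ψ, fun α => ?_, fun ψ' hψ' => ?_⟩
  · change ψ (ι (single (tau α) 1)) = T α
    rw [hψ, hρ.1.lift_single, one_smul, hρ.2]
  · refine NonUnitalStarAlgHom.ext_of_denseRange hd fun a => ?_
    have h1 : IsSemigroupRep fun s : ZM V => ψ' (ι (single s 1)) :=
      ⟨fun s t => by rw [hπ.map_mul, map_mul], fun s => by rw [hπ.map_star, map_star],
        by rw [hπ.map_zero, map_zero]⟩
    have h2 := h1.eq_of_tau hρ.1 fun α => (hψ' α).trans (hρ.2 α).symm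
    rw [hψ]
    induction a using MonoidAlgebra.induction_linear with
    | zero => simp only [map_zero]
    | add a b ha hb => simp only [map_add, ha, hb]
    | single s c =>
      have h3 : (single s c : MonoidAlgebra ℂ (ZM V)) = c • single s 1 := by simp
      rw [hρ.1.lift_single, h3, map_smul, map_smul, ← congrFun h2 s]

end UniversalAlgebra

end LCSC

theorem theorem7p6 {V : Type u} [Category.{v} V] [LCSC.LeftCancellative V]
    (hV : LCSC.FinitelyAligned V) :
    (∀ (B : Type w) [NonUnitalCStarAlgebra B] (T : Arrow V → B), LCSC.IsRepresentation T →
      ∃ π : LCSC.ZM V → B, LCSC.IsAssociated T π ∧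
        (∀ π' : LCSC.ZM V → B, LCSC.IsAssociated T π' → π' = π) ∧
        (LCSC.IsCovariant T ↔ LCSC.IsCoverToJoin π) ∧
        (LCSC.IsCoverToJoin π ↔ LCSC.IsTight π)) ∧
    (∃ (A : Type (max u v)) (_ : NonUnitalCStarAlgebra A) (t : Arrow V → A) (π : LCSC.ZM V → A),
      LCSC.IsCuntzKriegerAlgebra.{w} t ∧ LCSC.IsAssociated t π ∧
        LCSC.IsTightCStarAlgebra.{w} π) ∧
    (∀ (A : Type x) [NonUnitalCStarAlgebra A] (t : Arrow V → A) (π : LCSC.ZM V → A),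
      LCSC.IsAssociated t π →
        (LCSC.IsCuntzKriegerAlgebra.{w} t ↔ LCSC.IsTightCStarAlgebra.{w} π)) := by
  refine ⟨fun B _ T hT => ?_, ?_, fun A _ t π hπ => hπ.isCuntzKriegerAlgebra_iff hV⟩
  · obtain ⟨π, hπ⟩ := hT.exists_isAssociated hV
    have h := hπ.isCovariant_iff_isCoverToJoin hV hT
    exact ⟨π, hπ, fun π' hπ' => hπ'.unique hπ, h, h.symm.trans (hπ.isCovariant_iff_isTight hV)⟩
  · obtain ⟨A, _, t, ht⟩ := LCSC.exists_isCuntzKriegerAlgebra.{u, v, w} hV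
    obtain ⟨π, hπ⟩ := ht.1.toIsRepresentation.exists_isAssociated hV
    exact ⟨A, inferInstance, t, π, ht, hπ, (hπ.isCuntzKriegerAlgebra_iff hV).1 ht⟩
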